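/- Let $N\ge 2$ be an integer, $1<p<\infty$, $q=\frac{p}{p-1}$, $\varphi_m(\xi)=|\xi|^{m-2}\xi$, $\rho>0$, $x_0\in\mathbb R^N$, and let $B_\rho$ be the open ball of radius $\rho$ centred at $x_0$. Let $\omega_\rho:[0,\rho]\to[0,\infty)$ be continuous and not identically zero. Put $K(s,\theta)=(s/\theta)^{N-1}\omega_\rho(s)$, $$\phi_\rho(r)=\int_r^\rho\Big(\int_0^\theta K(s,\theta)\,ds\Big)^{\frac1{p-1}}d\theta,\qquad k_1=\|\phi_\rho\|_\infty^{-(p-1)},$$ $$k_2=\Big[\max_{0\le r\le\rho}\int_r^\rho\Big(\int_0^r K(s,\theta)\,ds\Big)^{\frac1{p-1}}d\theta\Big]^{1-p},\qquad \gamma_\rho=\max_{0\le r\le\rho}\varphi_q\Big(k_1\int_0^rK(s,r)\,ds\Big),$$ and let $t\in[0,\rho]$ be any point where the maximum in the definition of $k_2$ is attained. For $0<\delta<M$ and $0\le r\le\rho$ define $$\Psi_\delta(r)=\begin{cases}\delta,&0\le r\le t,\\ \delta\int_r^\rho\varphi_q\big(k_2\int_0^tK(s,\theta)\,ds\big)d\theta,&t<r\le\rho,\end{cases}$$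 $$\Phi_M(r)=M\int_r^\rho\varphi_q\Big(k_1\int_0^\theta K(s,\theta)\,ds\Big)d\theta,\qquad \Gamma_M(r)=M\varphi_q\Big(k_1\int_0^rK(s,r)\,ds\Big).$$ A (weak) solution of $-\Delta_p u=F(x,u,\nabla u)$ in $B_\rho$, $u=0$ on $\partial B_\rho$, where $\Delta_pu=\operatorname{div}(|\nabla u|^{p-2}\nabla u)$, is a function $u\in W^{1,p}(B_\rho)\cap L^\infty(B_\rho)\cap C(\overline{B_\rho})$ vanishing on $\partial B_\rho$ such that, for all $\eta\in C_c^\infty(B_\rho)$, $F(x,u,\nabla u)\eta$ is integrable and $\int_{B_\rho}|\nabla u|^{p-2}\nabla u\cdot\nabla\eta\,dx=\int_{B_\rho}F(x,u,\nabla u)\,\eta\,dx$. Let $f$ be a real function, continuous on $[0,\infty)\times[0,\infty)$, and suppose that for some $0<\delta<M$: (H1$_r$) $0\le f(u,|v|)\le k_1M^{p-1}$ whenever $0\le u\le M$ and $|v|\le\gamma_\rho M$; (H2$_r$) $f(u,|v|)\ge k_2\delta^{p-1}$ whenever $\delta\le u\le M$ and $|v|\le\gamma_\rho M$. Then $x\mapsto\phi_\rho(|x-x_0|)$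 is a solution of $-\Delta_p\phi=\omega_\rho(|x-x_0|)$ in $B_\rho$, $\phi=0$ on $\partial B_\rho$, and the problem $$-\Delta_pu=\omega_\rho(|x-x_0|)\,f(u,|\nabla u|)\ \text{ in }B_\rho,\qquad u=0\ \text{ on }\partial B_\rho,$$ has at least one radial solution $u_\rho\in C^1(\overline{B_\rho})$ with $u_\rho>0$ in $B_\rho$, satisfying $$\Psi_\delta(|x-x_0|)\le u_\rho(x)\le\Phi_M(|x-x_0|)\quad(x\in\overline{B_\rho}),\qquad |\nabla u_\rho(x)|\le\Gamma_M(|x-x_0|)\quad(x\in B_\rho).$$ In particular $\delta\le\|u_\rho\|_\infty\le M$ and $\|\nabla u_\rho\|_\infty\le\gamma_\rho M$. -/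

import Mathlib

open MeasureTheory Set Metric

namespace RadialPLaplace

noncomputable section

/-- The odd power `φ_m(ξ) = |ξ|^(m-2) ξ`. -/
def oddPow (m ξ : ℝ) : ℝ := |ξ| ^ (m - 2) * ξ

/-- The conjugate exponent `q = p / (p - 1)`. -/
def conj (p : ℝ) : ℝ := p / (p - 1)

/-- The kernel `K(s, θ) = (s / θ)^(N-1) w(s)`. -/
def kernel (N : ℕ) (w : ℝ → ℝ) (s θ : ℝ) : ℝ := (s / θ) ^ (N - 1) * w s

/-- The profile of the radial solution of `-Δ_p φ = w(|x - x₀|)` in the ball of radius `ρ`,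
`φ = 0` on its boundary. -/
def torsion (N : ℕ) (p ρ : ℝ) (w : ℝ → ℝ) (r : ℝ) : ℝ :=
  ∫ θ in r..ρ, (∫ s in (0 : ℝ)..θ, kernel N w s θ) ^ (1 / (p - 1))

/-- `k₁(B_ρ) = ‖φ_ρ‖_∞^(-(p-1))`. -/
def k₁ (N : ℕ) (p ρ : ℝ) (w : ℝ → ℝ) : ℝ :=
  (sSup ((fun r => |torsion N p ρ w r|) '' Icc 0 ρ)) ^ (-(p - 1))

/-- The function `r ↦ ∫_r^ρ (∫_0^r K(s, θ) ds)^(1/(p-1)) dθ` whose maximum defines `k₂`. -/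
def k₂Aux (N : ℕ) (p ρ : ℝ) (w : ℝ → ℝ) (r : ℝ) : ℝ :=
  ∫ θ in r..ρ, (∫ s in (0 : ℝ)..r, kernel N w s θ) ^ (1 / (p - 1))

/-- `k₂(B_ρ)`, the power `1 - p` of the maximum of `k₂Aux` on `[0, ρ]`. -/
def k₂ (N : ℕ) (p ρ : ℝ) (w : ℝ → ℝ) : ℝ :=
  (sSup (k₂Aux N p ρ w '' Icc 0 ρ)) ^ (1 - p)

/-- `γ_ρ = max_{0 ≤ r ≤ ρ} φ_q(k₁ ∫_0^r K(s, r) ds)`. -/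
def gam (N : ℕ) (p ρ : ℝ) (w : ℝ → ℝ) : ℝ :=
  sSup ((fun r => oddPow (conj p) (k₁ N p ρ w * ∫ s in (0 : ℝ)..r, kernel N w s r)) '' Icc 0 ρ)

/-- The lower barrier `Ψ_δ`; here `t` is a maximum point of `k₂Aux` on `[0, ρ]`. -/
def Psi (N : ℕ) (p ρ : ℝ) (w : ℝ → ℝ) (t δ r : ℝ) : ℝ :=
  if r ≤ t then δ
  else δ * ∫ θ in r..ρ, oddPow (conj p) (k₂ N p ρ w * ∫ s in (0 : ℝ)..t, kernel N w s θ)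

/-- The upper barrier `Φ_M`. -/
def Phi (N : ℕ) (p ρ : ℝ) (w : ℝ → ℝ) (M r : ℝ) : ℝ :=
  M * ∫ θ in r..ρ, oddPow (conj p) (k₁ N p ρ w * ∫ s in (0 : ℝ)..θ, kernel N w s θ)

/-- The gradient barrier `Γ_M`. -/
def Gam (N : ℕ) (p ρ : ℝ) (w : ℝ → ℝ) (M r : ℝ) : ℝ :=
  M * oddPow (conj p) (k₁ N p ρ w * ∫ s in (0 : ℝ)..r, kernel N w s r)

/-- `η ∈ C_c^∞(D)`. -/
structure IsTest {N : ℕ} (D : Set (EuclideanSpace ℝ (Fin N)))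
    (η : EuclideanSpace ℝ (Fin N) → ℝ) : Prop where
  smooth : ContDiff ℝ (⊤ : ℕ∞) η
  compact : HasCompactSupport η
  supp : tsupport η ⊆ D

/-- `u ∈ W^{1,p}(D)` with weak gradient `G`. -/
structure MemSobolev {N : ℕ} (p : ℝ) (D : Set (EuclideanSpace ℝ (Fin N)))
    (u : EuclideanSpace ℝ (Fin N) → ℝ)
    (G : EuclideanSpace ℝ (Fin N) → EuclideanSpace ℝ (Fin N)) : Prop where
  memLp : MemLp u (ENNReal.ofReal p) (volume.restrict D)
  memLp_grad : MemLp G (ENNReal.ofReal p) (volume.restrict D)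
  weak : ∀ η, IsTest D η → ∫ x in D, u x • gradient η x = -∫ x in D, η x • G x

/-- `u`, with weak gradient `G`, is a (bounded) weak solution of `-Δ_p u = F(x, u, ∇u)` in `D`,
`u = 0` on `∂D`. The boundary condition is attained continuously. -/
structure IsWeakSolution {N : ℕ} (p : ℝ) (D : Set (EuclideanSpace ℝ (Fin N)))
    (F : EuclideanSpace ℝ (Fin N) → ℝ → EuclideanSpace ℝ (Fin N) → ℝ)
    (u : EuclideanSpace ℝ (Fin N) → ℝ)
    (G : EuclideanSpace ℝ (Fin N) → EuclideanSpace ℝ (Fin N)) : Prop where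
  sobolev : MemSobolev p D u G
  bounded : MemLp u ⊤ (volume.restrict D)
  continuousOn : ContinuousOn u (closure D)
  boundary : ∀ x ∈ frontier D, u x = 0
  integrable : ∀ η, IsTest D η → IntegrableOn (fun x => F x (u x) (G x) * η x) D
  weak : ∀ η, IsTest D η →
    ∫ x in D, ‖G x‖ ^ (p - 2) * inner ℝ (G x) (gradient η x) = ∫ x in D, F x (u x) (G x) * η x

end

end RadialPLaplace

namespace RadialPLaplace

open Filter Topology

noncomputable section

/-! A decreasing radial profile `v` with `v(ρ) = 0` solves the equation as soon as `b = |v'|^(p-1)`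
is the weighted mean of the right-hand side `w f(v, |v'|)`, because the field `b(|x|) x / |x|` has
divergence equal to the averaged function. So `v` is the `torsion` of its own right-hand side, and
the PDE becomes a nonlocal integral equation for `b`.

That equation is solved for a bounded nonnegative right-hand side (`exists_radial_profile`) by
Tonelli's method. With a delay `ε` and a given central value `α`, `b` is determined on successive
intervals of length `ε`; the intermediate value theorem picks `α` so that the profile vanishes at
`ρ`. Averaging gives a Lipschitz bound independent of `ε`, and Arzelà–Ascoli lets `ε → 0`.

To have a bounded right-hand side, `f` is truncated: its first argument is forced into `[δ, M]` on
`[0, t]` and into `[0, M]` beyond, its second below `γ_ρ M`. The hypotheses then hold for all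
arguments. The upper bound gives `|v'| ≤ Γ_M` and `v ≤ Φ_M ≤ M`, since `k₁` normalises the torsion
function; the lower bound on `[0, t]` gives `v ≥ Ψ_δ`, since `k₂` is chosen so that the lower
barrier equals `δ` at `t`. Hence the truncation was inactive (`exists_source`), and
`isWeakSolution_radial` returns to the ball. -/

/-- The weighted mean `∫_0^r (s / r)^(N-1) g(s) ds`. -/
def mean (N : ℕ) (g : ℝ → ℝ) (r : ℝ) : ℝ := ∫ s in (0 : ℝ)..r, kernel N g s r

/-! ### Weighted means: bounds, monotonicity and Lipschitz continuity. -/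

section Mean

variable {N : ℕ} {g : ℝ → ℝ} {C : ℝ}

theorem mean_zero (N : ℕ) (g : ℝ → ℝ) : mean N g 0 = 0 := by simp [mean]

theorem mean_congr {g' : ℝ → ℝ} {r : ℝ} (hr : 0 ≤ r) (h : ∀ s ∈ Icc 0 r, g s = g' s) :
    mean N g r = mean N g' r := by
  refine intervalIntegral.integral_congr fun s hs => ?_
  rw [uIcc_of_le hr] at hs
  simp only [kernel, h s hs]

theorem kernel_nonneg {s θ : ℝ} (hs : 0 ≤ s) (hθ : 0 ≤ θ) (hg : 0 ≤ g s) :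
    0 ≤ kernel N g s θ :=
  mul_nonneg (pow_nonneg (div_nonneg hs hθ) _) hg

theorem div_pow_mem_Icc {s θ : ℝ} (hs : 0 ≤ s) (hsθ : s ≤ θ) (n : ℕ) :
    (s / θ) ^ n ∈ Icc (0 : ℝ) 1 :=
  ⟨pow_nonneg (div_nonneg hs (hs.trans hsθ)) _,
    pow_le_one₀ (div_nonneg hs (hs.trans hsθ)) (div_le_one_of_le₀ hsθ (hs.trans hsθ))⟩

theorem abs_kernel_le {s θ : ℝ} (hs : 0 ≤ s) (hsθ : s ≤ θ) (hg : |g s| ≤ C) :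
    |kernel N g s θ| ≤ C := by
  have h := div_pow_mem_Icc hs hsθ (N - 1)
  rw [kernel, abs_mul, abs_of_nonneg h.1]
  calc _ ≤ 1 * |g s| := by gcongr; exact h.2
    _ ≤ C := by simpa using hg

theorem measurable_kernel (hg : Measurable g) (θ : ℝ) : Measurable fun s => kernel N g s θ := by
  unfold kernel; fun_prop

theorem intervalIntegrable_of_abs_le {f : ℝ → ℝ} {a b : ℝ} (hab : a ≤ b) (hf : Measurable f)
    (h : ∀ s ∈ Icc a b, |f s| ≤ C) : IntervalIntegrable f volume a b := by
  rw [intervalIntegrable_iff_integrableOn_Icc_of_le hab]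
  refine Measure.integrableOn_of_bounded (M := C) (by simp) hf.aestronglyMeasurable ?_
  filter_upwards [ae_restrict_mem measurableSet_Icc] with s hs using h s hs

theorem intervalIntegrable_kernel (hg : Measurable g) (hgC : ∀ s, |g s| ≤ C) {a b θ : ℝ}
    (ha : 0 ≤ a) (hab : a ≤ b) (hb : b ≤ θ) :
    IntervalIntegrable (fun s => kernel N g s θ) volume a b :=
  intervalIntegrable_of_abs_le hab (measurable_kernel hg θ) fun s hs =>
    abs_kernel_le (ha.trans hs.1) (hs.2.trans hb) (hgC s)

theorem mean_nonneg {r : ℝ} (hr : 0 ≤ r) (hg : ∀ s ∈ Icc 0 r, 0 ≤ g s) : 0 ≤ mean N g r :=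
  intervalIntegral.integral_nonneg hr fun s hs => kernel_nonneg hs.1 hr (hg s hs)

theorem mean_mono {g' : ℝ → ℝ} {C' r : ℝ} (hr : 0 ≤ r) (hg : Measurable g)
    (hgC : ∀ s, |g s| ≤ C) (hg' : Measurable g') (hgC' : ∀ s, |g' s| ≤ C')
    (h : ∀ s ∈ Icc 0 r, g s ≤ g' s) : mean N g r ≤ mean N g' r :=
  intervalIntegral.integral_mono_on hr (intervalIntegrable_kernel hg hgC le_rfl hr le_rfl)
    (intervalIntegrable_kernel hg' hgC' le_rfl hr le_rfl) fun s hs =>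
    mul_le_mul_of_nonneg_left (h s hs) (div_pow_mem_Icc hs.1 hs.2 _).1

theorem abs_mean_le {r : ℝ} (hr : 0 ≤ r) (hgC : ∀ s, |g s| ≤ C) : |mean N g r| ≤ C * r := by
  have := intervalIntegral.norm_integral_le_of_norm_le_const (a := 0) (b := r) (C := C)
    (f := fun s => kernel N g s r) fun s hs => by
      rw [uIoc_of_le hr] at hs
      exact abs_kernel_le hs.1.le hs.2 (hgC s)
  simpa [abs_of_nonneg hr, mean] using this

theorem pow_mul_mean {r : ℝ} (hr : 0 < r) :
    r ^ (N - 1) * mean N g r = ∫ s in (0 : ℝ)..r, s ^ (N - 1) * g s := by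
  rw [mean, ← intervalIntegral.integral_const_mul]
  congr 1 with s
  rw [kernel, div_pow]
  field_simp

/-- The new interval `[r, r']` contributes `C (r' - r)`. On `[0, r]` the weight changes by at most
`N (r' - r) / r'`, and the length `r ≤ r'` of the interval cancels the denominator, so the constant
does not blow up at the origin. -/
theorem abs_mean_sub_mean_le (hg : Measurable g) (hgC : ∀ s, |g s| ≤ C) {r r' : ℝ} (hr : 0 ≤ r)
    (hrr' : r ≤ r') : |mean N g r' - mean N g r| ≤ C * (1 + N) * (r' - r) := by
  have hC : 0 ≤ C := (abs_nonneg _).trans (hgC 0)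
  rcases hr.eq_or_lt with rfl | hr
  · have := abs_mean_le (N := N) hrr' hgC
    rw [mean_zero]
    simp only [sub_zero]
    nlinarith [mul_nonneg (mul_nonneg hC N.cast_nonneg) hrr']
  have hr' : 0 < r' := hr.trans_le hrr'
  have e : mean N g r' - mean N g r = (∫ s in (0 : ℝ)..r, (kernel N g s r' - kernel N g s r)) +
      ∫ s in r..r', kernel N g s r' := by
    rw [intervalIntegral.integral_sub (intervalIntegrable_kernel hg hgC le_rfl hr.le hrr')
      (intervalIntegrable_kernel hg hgC le_rfl hr.le le_rfl), mean, mean,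
      ← intervalIntegral.integral_add_adjacent_intervals
        (intervalIntegrable_kernel hg hgC le_rfl hr.le hrr')
        (intervalIntegrable_kernel hg hgC hr.le hrr' le_rfl)]
    ring
  have h1 : |∫ s in r..r', kernel N g s r'| ≤ C * (r' - r) := by
    have := intervalIntegral.norm_integral_le_of_norm_le_const (a := r) (b := r') (C := C)
      (f := fun s => kernel N g s r') fun s hs => by
        rw [uIoc_of_le hrr'] at hs
        exact abs_kernel_le (hr.trans hs.1).le hs.2 (hgC s)
    simpa [abs_of_nonneg (sub_nonneg.2 hrr')] using this
  have h2 : |∫ s in (0 : ℝ)..r, (kernel N g s r' - kernel N g s r)| ≤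
      (C * N * ((r' - r) / r')) * r := by
    have := intervalIntegral.norm_integral_le_of_norm_le_const (a := 0) (b := r)
      (C := C * N * ((r' - r) / r'))
      (f := fun s => kernel N g s r' - kernel N g s r) fun s hs => by
        rw [uIoc_of_le hr.le] at hs
        have hs0 : 0 ≤ s := hs.1.le
        have ha : |s / r'| ≤ 1 := by
          rw [abs_of_nonneg (by positivity)]; exact div_le_one_of_le₀ (hs.2.trans hrr') hr'.le
        have hb : |s / r| ≤ 1 := by
          rw [abs_of_nonneg (by positivity)]; exact div_le_one_of_le₀ hs.2 hr.le
        have hd : |s / r' - s / r| ≤ (r' - r) / r' := by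
          rw [abs_sub_comm, abs_of_nonneg (by
            rw [sub_nonneg]; gcongr), div_sub_div _ _ hr.ne' hr'.ne', div_le_div_iff₀
            (by positivity) hr']
          have : s * (r' - r) ≤ r * (r' - r) := by
            apply mul_le_mul_of_nonneg_right hs.2; linarith
          nlinarith
        have hq : 0 ≤ (r' - r) / r' := div_nonneg (by linarith) hr'.le
        have hp : |(s / r') ^ (N - 1) - (s / r) ^ (N - 1)| ≤ N * ((r' - r) / r') := by
          calc _ ≤ |s / r' - s / r| * ((N - 1 : ℕ) : ℝ) * max |s / r'| |s / r| ^ (N - 1 - 1) :=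
                abs_pow_sub_pow_le _ _ _
            _ ≤ ((r' - r) / r') * N * 1 := by
                have hN : ((N - 1 : ℕ) : ℝ) ≤ N := by exact_mod_cast N.sub_le 1
                exact mul_le_mul (mul_le_mul hd hN (Nat.cast_nonneg _) hq)
                  (pow_le_one₀ (by positivity) (max_le ha hb)) (by positivity) (by positivity)
            _ = _ := by ring
        rw [kernel, kernel, ← sub_mul, Real.norm_eq_abs, abs_mul]
        calc _ ≤ N * ((r' - r) / r') * C := by
              exact mul_le_mul hp (hgC s) (abs_nonneg _) (by positivity)
          _ = _ := by ring
    simpa [abs_of_nonneg hr.le] using this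
  have h3 : (C * N * ((r' - r) / r')) * r ≤ C * N * (r' - r) := by
    have : (r' - r) / r' * r ≤ r' - r := by
      rw [div_mul_eq_mul_div, div_le_iff₀ hr']
      exact mul_le_mul_of_nonneg_left hrr' (by linarith)
    calc _ = C * N * ((r' - r) / r' * r) := by ring
      _ ≤ _ := by gcongr
  rw [e]
  refine (abs_add_le _ _).trans ?_
  linarith

/-- Projection of the line to `[0, ρ]`. -/
def clamp (ρ r : ℝ) : ℝ := max 0 (min r ρ)

theorem clamp_mem {ρ : ℝ} (hρ : 0 ≤ ρ) (r : ℝ) : clamp ρ r ∈ Icc 0 ρ :=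
  ⟨le_max_left _ _, max_le hρ (min_le_right _ _)⟩

theorem clamp_of_mem {ρ r : ℝ} (hr : r ∈ Icc 0 ρ) : clamp ρ r = r := by
  rw [clamp, min_eq_left hr.2, max_eq_right hr.1]

theorem continuous_clamp (ρ : ℝ) : Continuous (clamp ρ) := by unfold clamp; fun_prop

theorem abs_clamp_sub_clamp_le (ρ r r' : ℝ) : |clamp ρ r - clamp ρ r'| ≤ |r - r'| := by
  unfold clamp
  rw [max_comm, max_comm 0]
  exact (abs_max_sub_max_le_abs _ _ _).trans (abs_min_sub_min_le_max r ρ r' ρ |>.trans (by simp))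

theorem abs_mean_clamp_sub_le (hg : Measurable g) (hgC : ∀ s, |g s| ≤ C) {ρ : ℝ} (hρ : 0 ≤ ρ)
    (r r' : ℝ) :
    |mean N g (clamp ρ r) - mean N g (clamp ρ r')| ≤ C * (1 + N) * |r - r'| := by
  have hC : 0 ≤ C := (abs_nonneg _).trans (hgC 0)
  wlog h : clamp ρ r' ≤ clamp ρ r generalizing r r'
  · rw [abs_sub_comm, abs_sub_comm r]
    exact this r' r (le_of_not_ge h)
  refine (abs_mean_sub_mean_le hg hgC (clamp_mem hρ r').1 h).trans ?_
  gcongr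
  exact (le_abs_self _).trans (abs_clamp_sub_clamp_le ρ r r')

theorem continuous_of_abs_sub_le {b : ℝ → ℝ} {K : ℝ}
    (h : ∀ r r', |b r - b r'| ≤ K * |r - r'|) : Continuous b := by
  refine continuous_iff_continuousAt.2 fun x => ?_
  rw [ContinuousAt, tendsto_iff_dist_tendsto_zero]
  refine squeeze_zero (fun _ => dist_nonneg) (fun y => h y x) ?_
  have : Continuous fun y : ℝ => K * |y - x| := by fun_prop
  simpa using this.tendsto x

theorem continuous_mean_clamp (hg : Measurable g) (hgC : ∀ s, |g s| ≤ C) {ρ : ℝ} (hρ : 0 ≤ ρ) :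
    Continuous fun r => mean N g (clamp ρ r) :=
  continuous_of_abs_sub_le (abs_mean_clamp_sub_le hg hgC hρ)

theorem continuousOn_mean (hg : Measurable g) (hgC : ∀ s, |g s| ≤ C) {ρ : ℝ} (hρ : 0 ≤ ρ) :
    ContinuousOn (mean N g) (Icc 0 ρ) :=
  (continuous_mean_clamp (N := N) hg hgC hρ).continuousOn.congr fun r hr => by
    simp only [clamp_of_mem hr]

end Mean

/-! ### The integral equation: delay, shooting and compactness. -/

section Existence

/-- The right-hand side `h(s, v(s), |v'(s)|)` along the profile `v = α - ∫_0^s β^c`. -/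
def source (h : ℝ → ℝ → ℝ → ℝ) (c α : ℝ) (β : ℝ → ℝ) (s : ℝ) : ℝ :=
  h s (α - ∫ τ in (0 : ℝ)..s, β τ ^ c) (β s ^ c)

variable {h : ℝ → ℝ → ℝ → ℝ} {c C ρ : ℝ} {N : ℕ}

theorem continuous_rpow_comp {β : ℝ → ℝ} (hc : 0 ≤ c) (hβ : Continuous β) :
    Continuous fun s => β s ^ c :=
  (Real.continuous_rpow_const hc).comp hβ

theorem continuous_primitive_rpow {β : ℝ → ℝ} (hc : 0 ≤ c) (hβ : Continuous β) :
    Continuous fun s => ∫ τ in (0 : ℝ)..s, β τ ^ c :=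
  intervalIntegral.continuous_primitive
    (fun _ _ => (continuous_rpow_comp hc hβ).intervalIntegrable _ _) 0

theorem measurable_source (hm : Measurable fun x : ℝ × ℝ × ℝ => h x.1 x.2.1 x.2.2) (hc : 0 ≤ c)
    (α : ℝ) {β : ℝ → ℝ} (hβ : Continuous β) : Measurable (source h c α β) := by
  have h1 := (continuous_primitive_rpow hc hβ).measurable
  have h2 := (continuous_rpow_comp hc hβ).measurable
  exact hm.comp (measurable_id.prodMk ((h1.const_sub α).prodMk h2))

theorem tendsto_integral_rpow {ι : Type*} {l : Filter ι} [l.IsCountablyGenerated] (hc : 0 ≤ c)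
    {β : ι → ℝ → ℝ} {β' : ℝ → ℝ} {B : ℝ} (hβ : ∀ i, Continuous (β i))
    (hB : ∀ i s, |β i s| ≤ B) (hlim : ∀ s, Tendsto (fun i => β i s) l (𝓝 (β' s))) (a b : ℝ) :
    Tendsto (fun i => ∫ τ in a..b, β i τ ^ c) l (𝓝 (∫ τ in a..b, β' τ ^ c)) := by
  refine intervalIntegral.tendsto_integral_filter_of_dominated_convergence (fun _ => B ^ c)
    (.of_forall fun i => (continuous_rpow_comp hc (hβ i)).aestronglyMeasurable)
    (.of_forall fun i => .of_forall fun s _ => ?_) (by simp)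
    (.of_forall fun s _ => ?_)
  · exact (Real.abs_rpow_le_abs_rpow _ _).trans
      (Real.rpow_le_rpow (abs_nonneg _) (hB i s) hc)
  · exact ((Real.continuous_rpow_const hc).tendsto _).comp (hlim s)

/-- Dominated convergence needs continuity of `h s` only for each fixed `s`; measurability in `s`
suffices, so a cut-off that jumps in `s` is admissible. -/
theorem tendsto_mean_source {ι : Type*} {l : Filter ι} [l.IsCountablyGenerated]
    (hm : Measurable fun x : ℝ × ℝ × ℝ => h x.1 x.2.1 x.2.2)
    (hcont : ∀ s, Continuous fun y : ℝ × ℝ => h s y.1 y.2) (hb : ∀ s u z, |h s u z| ≤ C)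
    (hc : 0 ≤ c) {α : ι → ℝ} {α' : ℝ} (hα : Tendsto α l (𝓝 α'))
    {β : ι → ℝ → ℝ} {β' : ℝ → ℝ} {B : ℝ} (hβ : ∀ i, Continuous (β i))
    (hB : ∀ i s, |β i s| ≤ B) (hlim : ∀ s, Tendsto (fun i => β i s) l (𝓝 (β' s)))
    {r : ℝ} (hr : 0 ≤ r) :
    Tendsto (fun i => mean N (source h c (α i) (β i)) r) l
      (𝓝 (mean N (source h c α' β') r)) := by
  refine intervalIntegral.tendsto_integral_filter_of_dominated_convergence (fun _ => C)
    (.of_forall fun i =>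
      (measurable_kernel (measurable_source hm hc _ (hβ i)) r).aestronglyMeasurable)
    (.of_forall fun i => .of_forall fun s hs => ?_) (by simp)
    (.of_forall fun s _ => ?_)
  · rw [uIoc_of_le hr] at hs
    exact abs_kernel_le hs.1.le hs.2 (hb _ _ _)
  · refine Tendsto.const_mul _ ?_
    exact ((hcont s).tendsto _).comp ((hα.sub (tendsto_integral_rpow hc hβ hB hlim 0 s)).prodMk_nhds
      (((Real.continuous_rpow_const hc).tendsto _).comp (hlim s)))

/-- The iterates of the radial integral operator with delay `ε`, for the value `α` at the centre. -/
def delayIter (N : ℕ) (h : ℝ → ℝ → ℝ → ℝ) (c ρ ε : ℝ) : ℕ → ℝ → ℝ → ℝ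
  | 0, _, _ => 0
  | k + 1, α, r =>
    mean N (source h c α fun s => delayIter N h c ρ ε k α (s - ε)) (clamp ρ r)

theorem continuous_delayIter (hm : Measurable fun x : ℝ × ℝ × ℝ => h x.1 x.2.1 x.2.2)
    (hb : ∀ s u z, |h s u z| ≤ C) (hc : 0 ≤ c) (hρ : 0 ≤ ρ) (ε : ℝ) (k : ℕ) (α : ℝ) :
    Continuous (delayIter N h c ρ ε k α) := by
  induction k with
  | zero => exact continuous_const
  | succ k ih =>
    exact continuous_mean_clamp (measurable_source hm hc α (ih.comp (continuous_sub_right ε)))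
      (fun s => hb _ _ _) hρ

theorem abs_delayIter_le (hb : ∀ s u z, |h s u z| ≤ C) (hρ : 0 ≤ ρ) (ε : ℝ) (k : ℕ) (α r : ℝ) :
    |delayIter N h c ρ ε k α r| ≤ C * ρ := by
  have hC : 0 ≤ C := (abs_nonneg _).trans (hb 0 0 0)
  cases k with
  | zero => simpa [delayIter] using mul_nonneg hC hρ
  | succ k =>
    refine (abs_mean_le (clamp_mem hρ r).1 fun s => hb _ _ _).trans ?_
    gcongr
    exact (clamp_mem hρ r).2

theorem delayIter_nonneg (hb0 : ∀ s u z, 0 ≤ h s u z) (hρ : 0 ≤ ρ) (ε : ℝ) (k : ℕ) (α r : ℝ) :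
    0 ≤ delayIter N h c ρ ε k α r := by
  cases k with
  | zero => exact le_rfl
  | succ k => exact mean_nonneg (clamp_mem hρ r).1 fun s _ => hb0 _ _ _

/-- Pointwise convergence of one iterate as `α` varies passes to the next by dominated convergence.
This feeds the intermediate value argument for the central value. -/
theorem continuous_delayIter_param (hm : Measurable fun x : ℝ × ℝ × ℝ => h x.1 x.2.1 x.2.2)
    (hcont : ∀ s, Continuous fun y : ℝ × ℝ => h s y.1 y.2)
    (hb : ∀ s u z, |h s u z| ≤ C) (hc : 0 ≤ c) (hρ : 0 ≤ ρ) (ε : ℝ) (k : ℕ) (r : ℝ) :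
    Continuous fun α => delayIter N h c ρ ε k α r := by
  induction k generalizing r with
  | zero => exact continuous_const
  | succ k ih =>
    refine continuous_iff_continuousAt.2 fun α => ?_
    exact tendsto_mean_source (α := id) hm hcont hb hc tendsto_id
      (fun i => (continuous_delayIter hm hb hc hρ ε k i).comp (continuous_sub_right ε))
      (fun i s => abs_delayIter_le hb hρ ε k i (s - ε))
      (fun s => (ih (s - ε)).tendsto α) (clamp_mem hρ r).1

/-- Causality of the source: it sees the past of `β` only. With a delay this makes the iteration
terminate. -/
theorem source_congr {α : ℝ} {β β' : ℝ → ℝ} {s : ℝ} (hs : 0 ≤ s)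
    (hβ : ∀ τ ∈ Icc 0 s, β τ = β' τ) : source h c α β s = source h c α β' s := by
  rw [source, source, hβ s ⟨hs, le_rfl⟩, intervalIntegral.integral_congr fun τ hτ => ?_]
  rw [uIcc_of_le hs] at hτ
  simp only [hβ τ hτ]

/-- An iterate at `r` uses the preceding one only up to `r - ε`, so each iteration extends the range
of stabilisation by `ε`. -/
theorem delayIter_succ_eq {ε : ℝ} (hρ : 0 ≤ ρ) (k : ℕ) (α r : ℝ) (hr : clamp ρ r ≤ k * ε) :
    delayIter N h c ρ ε (k + 1) α r = delayIter N h c ρ ε k α r := by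
  -- To the left of the origin every iterate is a mean over a degenerate interval, hence the delayed
  -- argument `s - ε < 0` is harmless.
  have h0 : ∀ r, clamp ρ r ≤ 0 → ∀ k, delayIter N h c ρ ε k α r = 0 := fun r hr k => by
    cases k with
    | zero => rfl
    | succ k => rw [delayIter, le_antisymm hr (clamp_mem hρ r).1, mean_zero]
  induction k generalizing r with
  | zero => exact h0 r (by simpa using hr) 1
  | succ k ih =>
    refine mean_congr (clamp_mem hρ r).1 fun s hs => source_congr hs.1 fun τ hτ => ?_
    have hτρ : τ ≤ ρ := hτ.2.trans (hs.2.trans (clamp_mem hρ r).2)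
    have hτr : τ ≤ (k + 1 : ℕ) * ε := hτ.2.trans (hs.2.trans hr)
    rcases le_total (clamp ρ (τ - ε)) 0 with h1 | h1
    · rw [h0 _ h1, h0 _ h1]
    rcases h1.eq_or_lt with h1 | h1
    · rw [h0 _ h1.ge, h0 _ h1.ge]
    apply ih
    push_cast at hτr
    have : 0 < τ - ε := by
      by_contra! h2
      apply h1.not_ge
      exact max_le le_rfl ((min_le_left _ _).trans h2)
    refine max_le (by nlinarith) ((min_le_left _ _).trans (by linarith))

/-- A radial profile with delay `ε`: `α` is chosen so that the profile vanishes at `ρ`. -/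
theorem exists_delayed_profile (hm : Measurable fun x : ℝ × ℝ × ℝ => h x.1 x.2.1 x.2.2)
    (hcont : ∀ s, Continuous fun y : ℝ × ℝ => h s y.1 y.2)
    (hb0 : ∀ s u z, 0 ≤ h s u z) (hb : ∀ s u z, |h s u z| ≤ C) (hc : 0 ≤ c) (hρ : 0 ≤ ρ)
    {ε : ℝ} (hε : 0 < ε) :
    ∃ b : ℝ → ℝ, (∀ r, b r ∈ Icc 0 (C * ρ)) ∧
      (∀ r r', |b r - b r'| ≤ C * (1 + N) * |r - r'|) ∧
      ∀ r, b r = mean N (source h c (∫ τ in (0 : ℝ)..ρ, b (τ - ε) ^ c) fun s => b (s - ε))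
        (clamp ρ r) := by
  -- With `k ε ≥ ρ` the `k`-th iterate has stabilised on all of `[0, ρ]` and solves the delayed
  -- equation exactly.
  obtain ⟨k, hk⟩ := exists_nat_ge (ρ / ε)
  rw [div_le_iff₀ hε] at hk
  have hC : 0 ≤ C := (abs_nonneg _).trans (hb 0 0 0)
  -- `V α` is the value at `ρ` of the profile started from `α`. It is nonpositive at `α = 0`, and
  -- nonnegative at `(C ρ)^c ρ`, which bounds the total descent.
  set V : ℝ → ℝ := fun α => α - ∫ τ in (0 : ℝ)..ρ, delayIter N h c ρ ε k α (τ - ε) ^ c with hV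
  have hVc : Continuous V := by
    refine continuous_id.sub (continuous_iff_continuousAt.2 fun α => ?_)
    exact tendsto_integral_rpow hc
      (fun i => (continuous_delayIter hm hb hc hρ ε k i).comp (continuous_sub_right ε))
      (fun i s => abs_delayIter_le (N := N) (c := c) hb hρ ε k i (s - ε))
      (fun s => (continuous_delayIter_param hm hcont hb hc hρ ε k (s - ε)).tendsto α) 0 ρ
  have hT : (0 : ℝ) ≤ (C * ρ) ^ c * ρ := mul_nonneg (Real.rpow_nonneg (mul_nonneg hC hρ) _) hρ
  have h0 : V 0 ≤ 0 := by
    simp only [hV, zero_sub, neg_nonpos]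
    exact intervalIntegral.integral_nonneg hρ fun τ _ =>
      Real.rpow_nonneg (delayIter_nonneg hb0 hρ ε k _ _) _
  have h1 : 0 ≤ V ((C * ρ) ^ c * ρ) := by
    have := intervalIntegral.norm_integral_le_of_norm_le_const (a := 0) (b := ρ)
      (C := (C * ρ) ^ c)
      (f := fun τ => delayIter N h c ρ ε k ((C * ρ) ^ c * ρ) (τ - ε) ^ c) fun s hs =>
        (Real.abs_rpow_le_abs_rpow _ _).trans
          (Real.rpow_le_rpow (abs_nonneg _) (abs_delayIter_le hb hρ ε k _ _) hc)
    rw [sub_zero, abs_of_nonneg hρ] at this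
    exact sub_nonneg.2 ((le_abs_self _).trans this)
  obtain ⟨α, -, hα⟩ := intermediate_value_Icc hT hVc.continuousOn ⟨h0, h1⟩
  have hα' : (∫ τ in (0 : ℝ)..ρ, delayIter N h c ρ ε k α (τ - ε) ^ c) = α :=
    (sub_eq_zero.1 hα).symm
  have heq : ∀ r, delayIter N h c ρ ε k α r = delayIter N h c ρ ε (k + 1) α r := fun r =>
    (delayIter_succ_eq hρ k α r ((clamp_mem hρ r).2.trans hk)).symm
  refine ⟨delayIter N h c ρ ε k α, fun r => ⟨delayIter_nonneg hb0 hρ ε k α r,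
    (le_abs_self _).trans (abs_delayIter_le hb hρ ε k α r)⟩, fun r r' => ?_, fun r => ?_⟩
  · rw [heq r, heq r']
    exact abs_mean_clamp_sub_le (measurable_source hm hc α
      ((continuous_delayIter hm hb hc hρ ε k α).comp (continuous_sub_right ε)))
      (fun s => hb _ _ _) hρ r r'
  · rw [hα']
    exact heq r

/-- Compactness of uniformly bounded, uniformly Lipschitz functions that depend only on the
projection to `[0, ρ]`. -/
theorem exists_tendsto_subseq_of_lipschitz {b : ℕ → ℝ → ℝ} {B K : ℝ} (hρ : 0 ≤ ρ)
    (hB : ∀ n r, b n r ∈ Icc 0 B) (hK : ∀ n r r', |b n r - b n r'| ≤ K * |r - r'|)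
    (hcl : ∀ n r, b n r = b n (clamp ρ r)) :
    ∃ (b' : ℝ → ℝ) (φ : ℕ → ℕ), StrictMono φ ∧
      ∀ r, Tendsto (fun n => b (φ n) r) atTop (𝓝 (b' r)) := by
  let A : Set (BoundedContinuousFunction (Icc 0 ρ) ℝ) :=
    {f | (∀ x, f x ∈ Icc 0 B) ∧ ∀ x y : Icc 0 ρ, |f x - f y| ≤ K * |(x : ℝ) - y|}
  have hA : IsCompact A := by
    refine BoundedContinuousFunction.arzela_ascoli₂ (Icc 0 B) isCompact_Icc A ?_
      (fun f x hf => hf.1 x) ?_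
    · have ev (x : Icc 0 ρ) : Continuous fun f : BoundedContinuousFunction (Icc 0 ρ) ℝ => f x :=
        continuous_eval_const _
      have e : A = (⋂ x : Icc 0 ρ, {f | f x ∈ Icc 0 B}) ∩
          ⋂ x : Icc 0 ρ, ⋂ y : Icc 0 ρ, {f | |f x - f y| ≤ K * |(x : ℝ) - y|} := by
        ext f; simp only [A, mem_inter_iff, mem_iInter, mem_ofPred_eq]
      rw [e]
      exact (isClosed_iInter fun x => isClosed_Icc.preimage (ev x)).inter
        (isClosed_iInter fun x => isClosed_iInter fun y =>
          isClosed_le ((ev x).sub (ev y)).abs continuous_const)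
    · refine Metric.equicontinuous_of_continuity_modulus (fun x => K * x) ?_ _ fun x y f => ?_
      · have : Continuous fun x : ℝ => K * x := by fun_prop
        simpa using this.tendsto 0
      · exact f.2.2 x y
  let F : ℕ → BoundedContinuousFunction (Icc 0 ρ) ℝ := fun n =>
    BoundedContinuousFunction.mkOfCompact
      ⟨fun x => b n x, (continuous_of_abs_sub_le (hK n)).comp continuous_subtype_val⟩
  obtain ⟨f, -, φ, hφ, hlim⟩ := hA.tendsto_subseq (x := F)
    fun n => ⟨fun x => hB n x, fun x y => hK n x y⟩
  refine ⟨fun r => f ⟨clamp ρ r, clamp_mem hρ r⟩, φ, hφ, fun r => ?_⟩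
  have := ((continuous_eval_const (F := BoundedContinuousFunction (Icc 0 ρ) ℝ)
    (⟨clamp ρ r, clamp_mem hρ r⟩ : Icc 0 ρ)).tendsto f).comp hlim
  refine this.congr fun n => (hcl (φ n) r).symm

/-- The bounds on the delayed solutions do not depend on the delay, so a subsequence converges as
the delay `1 / (n + 1)` tends to zero, and every term of the equation passes to the limit. -/
theorem exists_radial_profile (hm : Measurable fun x : ℝ × ℝ × ℝ => h x.1 x.2.1 x.2.2)
    (hcont : ∀ s, Continuous fun y : ℝ × ℝ => h s y.1 y.2)
    (hb0 : ∀ s u z, 0 ≤ h s u z) (hb : ∀ s u z, |h s u z| ≤ C) (hc : 0 ≤ c) (hρ : 0 ≤ ρ) :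
    ∃ b : ℝ → ℝ, Continuous b ∧ (∀ r, 0 ≤ b r) ∧
      ∀ r ∈ Icc 0 ρ, b r = mean N (source h c (∫ τ in (0 : ℝ)..ρ, b τ ^ c) b) r := by
  have hε : ∀ n : ℕ, (0 : ℝ) < 1 / ((n : ℝ) + 1) := fun n => by positivity
  choose b hB hK heq using fun n : ℕ =>
    exists_delayed_profile (N := N) hm hcont hb0 hb hc hρ (hε n)
  obtain ⟨b', φ, hφ, hlim⟩ := exists_tendsto_subseq_of_lipschitz hρ hB hK fun n r => by
    rw [heq n r, heq n (clamp ρ r), clamp_of_mem (clamp_mem hρ r)]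
  have hK' : ∀ r r', |b' r - b' r'| ≤ C * (1 + N) * |r - r'| := fun r r' =>
    le_of_tendsto ((hlim r).sub (hlim r')).abs (.of_forall fun n => hK (φ n) r r')
  refine ⟨b', continuous_of_abs_sub_le hK', fun r =>
    ge_of_tendsto (hlim r) (.of_forall fun n => (hB (φ n) r).1), fun r hr => ?_⟩
  -- The common Lipschitz constant makes the shifted and unshifted values asymptotically equal.
  have hshift : ∀ s, Tendsto (fun n => b (φ n) (s - 1 / ((φ n : ℝ) + 1))) atTop (𝓝 (b' s)) := by
    intro s
    have h0 : Tendsto (fun n => b (φ n) (s - 1 / ((φ n : ℝ) + 1)) - b (φ n) s) atTop (𝓝 0) := by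
      refine squeeze_zero_norm (a := fun n => C * (1 + N) * (1 / ((φ n : ℝ) + 1))) (fun n => ?_) ?_
      · refine (hK (φ n) _ _).trans_eq ?_
        rw [sub_sub_cancel_left, abs_neg, abs_of_pos (hε (φ n))]
      · simpa using (tendsto_one_div_add_atTop_nhds_zero_nat.comp hφ.tendsto_atTop).const_mul
          (C * (1 + N))
    simpa using h0.add (hlim s)
  have hcts : ∀ n, Continuous fun s => b (φ n) (s - 1 / ((φ n : ℝ) + 1)) := fun n =>
    (continuous_of_abs_sub_le (hK (φ n))).comp (continuous_sub_right _)
  have hbd : ∀ n s, |b (φ n) (s - 1 / ((φ n : ℝ) + 1))| ≤ C * ρ := fun n s => by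
    rw [abs_of_nonneg (hB _ _).1]; exact (hB _ _).2
  have hα := tendsto_integral_rpow hc hcts hbd hshift 0 ρ
  have hT := tendsto_mean_source (N := N) hm hcont hb hc hα hcts hbd hshift hr.1
  refine tendsto_nhds_unique (hlim r) (hT.congr fun n => ?_)
  rw [heq (φ n) r, clamp_of_mem hr]

end Existence

/-! ### Polar coordinates, the radial divergence identity and regularity at the centre. -/

section Radial

variable {N : ℕ} {g : ℝ → ℝ} {C : ℝ}

/-- Fubini on the product of the unit sphere and the half-line with density `r^(N-1)`: the integral
vanishes because it does so on every ray. -/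
theorem integral_eq_zero_of_radial (hN : N ≠ 0) {F : EuclideanSpace ℝ (Fin N) → ℝ}
    (hF : Integrable F)
    (h : ∀ σ : EuclideanSpace ℝ (Fin N), ‖σ‖ = 1 →
      ∫ r in Ioi (0 : ℝ), r ^ (N - 1) * F (r • σ) = 0) : ∫ x, F x = 0 := by
  have : Nonempty (Fin N) := Fin.pos_iff_nonempty.1 (Nat.pos_of_ne_zero hN)
  have hd : Module.finrank ℝ (EuclideanSpace ℝ (Fin N)) = N := finrank_euclideanSpace_fin
  set μ : Measure (EuclideanSpace ℝ (Fin N)) := volume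
  have hmp := μ.measurePreserving_homeomorphUnitSphereProd
  rw [hd] at hmp
  set Φ := homeomorphUnitSphereProd (EuclideanSpace ℝ (Fin N))
  have hinv : ∀ y, (Φ.symm y : EuclideanSpace ℝ (Fin N)) = (y.2 : ℝ) • (y.1 : _) := fun y => rfl
  calc ∫ x, F x ∂μ = ∫ x : ({(0)}ᶜ : Set (EuclideanSpace ℝ (Fin N))), F x ∂(μ.comap (↑)) := by
        rw [integral_subtype_comap (measurableSet_singleton _).compl, restrict_compl_singleton]
    _ = ∫ y, F (Φ.symm y) ∂(μ.toSphere.prod (.volumeIoiPow (N - 1))) := by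
        rw [← hmp.integral_comp (Homeomorph.measurableEmbedding _)]
        simp
    _ = ∫ σ, ∫ r, F (Φ.symm (σ, r)) ∂(.volumeIoiPow (N - 1)) ∂μ.toSphere := by
        refine integral_prod _ ?_
        rw [← hmp.integrable_comp_emb (Homeomorph.measurableEmbedding _)]
        have : (fun y => F (Φ.symm y)) ∘ Φ = F ∘ Subtype.val := by ext x; simp
        rw [this, ← integrableOn_iff_comap_subtypeVal (measurableSet_singleton _).compl]
        exact hF.integrableOn
    _ = ∫ σ, (0 : ℝ) ∂μ.toSphere := by
        congr 1 with σ
        simp only [hinv, Measure.volumeIoiPow, ENNReal.ofReal]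
        rw [integral_withDensity_eq_integral_smul, integral_subtype_comap measurableSet_Ioi
          fun a => Real.toNNReal (a ^ (N - 1)) • F (a • (σ : EuclideanSpace ℝ (Fin N)))]
        · refine (setIntegral_congr_fun measurableSet_Ioi fun x hx => ?_).trans (h σ (by simp))
          rw [NNReal.smul_def, Real.coe_toNNReal _ (pow_nonneg (le_of_lt hx) _), smul_eq_mul]
        · exact (measurable_subtype_coe.pow_const _).real_toNNReal
    _ = 0 := by simp

theorem continuous_mean_max (hg : Measurable g) (hgC : ∀ s, |g s| ≤ C) :
    Continuous fun r => mean N g (max r 0) := by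
  refine continuous_of_abs_sub_le (K := C * (1 + N)) fun r r' => ?_
  have hC : 0 ≤ C := (abs_nonneg _).trans (hgC 0)
  wlog h : r' ≤ r generalizing r r'
  · rw [abs_sub_comm, abs_sub_comm r]
    exact this r' r (le_of_not_ge h)
  refine (abs_mean_sub_mean_le hg hgC (le_max_right r' 0) (max_le_max_right 0 h)).trans ?_
  gcongr
  exact (le_abs_self _).trans (abs_max_sub_max_le_abs r r' 0)

/-- The field `b(|x|) x / |x|`, where `b` is the weighted mean of `g`, has divergence `g(|x|)`. -/
theorem integral_mean_mul_fderiv (hN : 2 ≤ N) (hg : Continuous g) (hgC : ∀ s, |g s| ≤ C)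
    {η : EuclideanSpace ℝ (Fin N) → ℝ} (hη : ContDiff ℝ 1 η) (hη' : HasCompactSupport η) :
    Integrable (fun x => mean N g ‖x‖ * ‖x‖⁻¹ * fderiv ℝ η x x) ∧
      Integrable (fun x => g ‖x‖ * η x) ∧
      ∫ x, mean N g ‖x‖ * ‖x‖⁻¹ * fderiv ℝ η x x = -∫ x, g ‖x‖ * η x := by
  have hC : 0 ≤ C := (abs_nonneg _).trans (hgC 0)
  have hfd : Continuous (fderiv ℝ η) := hη.continuous_fderiv one_ne_zero
  have i1 : Integrable (fun x => mean N g ‖x‖ * ‖x‖⁻¹ * fderiv ℝ η x x) := by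
    have hd : Integrable fun x => C * (‖fderiv ℝ η x‖ * ‖x‖) := by
      refine Continuous.integrable_of_hasCompactSupport (by fun_prop) ?_
      exact ((hη'.fderiv (𝕜 := ℝ)).norm.mul_right).mul_left
    refine hd.mono' ?_ (.of_forall fun x => ?_)
    · have hm : Continuous fun x : EuclideanSpace ℝ (Fin N) => mean N g ‖x‖ := by
        refine ((continuous_mean_max (N := N) hg.measurable hgC).comp continuous_norm).congr
          fun x => ?_
        simp
      have hm2 : Continuous fun x => fderiv ℝ η x x := hfd.clm_apply continuous_id
      exact ((hm.measurable.mul measurable_norm.inv).mul hm2.measurable).aestronglyMeasurable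
    · rw [Real.norm_eq_abs, abs_mul]
      refine mul_le_mul ?_ ((fderiv ℝ η x).le_opNorm x) (abs_nonneg _) hC
      rcases eq_or_ne x 0 with rfl | hx
      · simpa using hC
      rw [abs_mul, abs_inv, abs_norm, ← div_eq_mul_inv, div_le_iff₀ (norm_pos_iff.2 hx)]
      exact abs_mean_le (norm_nonneg x) hgC
  have i2 : Integrable (fun x => g ‖x‖ * η x) :=
    Continuous.integrable_of_hasCompactSupport
      ((hg.comp continuous_norm).mul hη.continuous) hη'.mul_left
  refine ⟨i1, i2, ?_⟩
  rw [eq_neg_iff_add_eq_zero, ← integral_add i1 i2]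
  refine integral_eq_zero_of_radial (by omega) (i1.add i2) fun σ hσ => ?_
  -- On a ray the weighted integrand is the derivative of `H r * η (r • σ)`, where `H r = r^(N-1) *
  -- mean N g r`. The boundary terms vanish: `H 0 = 0` and `η` has compact support.
  set H : ℝ → ℝ := fun r => ∫ s in (0 : ℝ)..r, s ^ (N - 1) * g s with hH
  have hHc : Continuous fun s : ℝ => s ^ (N - 1) * g s := by fun_prop
  have hH' : ∀ r, HasDerivAt H (r ^ (N - 1) * g r) r := fun r =>
    hHc.integral_hasStrictDerivAt 0 r |>.hasDerivAt
  have hη1 : ∀ r : ℝ, HasDerivAt (fun r : ℝ => η (r • σ)) (fderiv ℝ η (r • σ) σ) r := fun r => by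
    have := ((hη.differentiable one_ne_zero) (r • σ)).hasFDerivAt.comp_hasDerivAt r
      ((hasDerivAt_id r).smul_const σ)
    simpa [Function.comp_def] using! this
  have hP : ∀ r, HasDerivAt (fun r => H r * η (r • σ))
      (r ^ (N - 1) * g r * η (r • σ) + H r * fderiv ℝ η (r • σ) σ) r := fun r =>
    (hH' r).mul (hη1 r)
  have hHcont : Continuous H := continuous_iff_continuousAt.2 fun r => (hH' r).continuousAt
  have hP1 : ContDiff ℝ 1 fun r => H r * η (r • σ) := by
    rw [contDiff_one_iff_deriv]
    refine ⟨fun r => (hP r).differentiableAt, ?_⟩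
    rw [funext fun r => (hP r).deriv]
    have : Continuous fun r : ℝ => fderiv ℝ η (r • σ) σ :=
      (hfd.comp (by fun_prop)).clm_apply continuous_const
    have h2 : Continuous fun r : ℝ => η (r • σ) := hη.continuous.comp (by fun_prop)
    fun_prop
  have hP2 : HasCompactSupport fun r => H r * η (r • σ) := by
    refine HasCompactSupport.mul_left (f := H) (f' := fun r : ℝ => η (r • σ)) ?_
    obtain ⟨R, hR⟩ := hη'.isBounded.subset_closedBall 0
    refine HasCompactSupport.of_support_subset_isCompact (isCompact_closedBall (0 : ℝ) R)
      fun r hr => ?_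
    have := hR (subset_tsupport η hr)
    simpa [norm_smul, hσ] using this
  have h0 := hP2.integral_Ioi_deriv_eq hP1 0
  have hH0 : H 0 = 0 := by simp [hH]
  rw [hH0, zero_mul, neg_zero] at h0
  refine (setIntegral_congr_fun measurableSet_Ioi fun r (hr : 0 < r) => ?_).trans h0
  simp only [(hP r).deriv]
  have hn : ‖r • σ‖ = r := by rw [norm_smul, hσ, mul_one, Real.norm_of_nonneg hr.le]
  rw [hn, show H r = r ^ (N - 1) * mean N g r from (pow_mul_mean hr).symm, map_smul, smul_eq_mul]
  field_simp
  ring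

/-- The gradient of `x ↦ torsion N p ρ g ‖x - x₀‖`. -/
def radialGrad (N : ℕ) (p : ℝ) (g : ℝ → ℝ) (x₀ x : EuclideanSpace ℝ (Fin N)) :
    EuclideanSpace ℝ (Fin N) :=
  -(mean N g ‖x - x₀‖ ^ (1 / (p - 1)) * ‖x - x₀‖⁻¹) • (x - x₀)

variable {p ρ : ℝ} {x₀ : EuclideanSpace ℝ (Fin N)}

theorem norm_radialGrad (hp : 1 < p) (hg0 : ∀ s, 0 ≤ g s) (x : EuclideanSpace ℝ (Fin N)) :
    ‖radialGrad N p g x₀ x‖ = mean N g ‖x - x₀‖ ^ (1 / (p - 1)) := by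
  have hc : 0 < 1 / (p - 1) := one_div_pos.2 (sub_pos.2 hp)
  rw [radialGrad, neg_smul, norm_neg, norm_smul]
  rcases eq_or_ne (x - x₀) 0 with hx | hx
  · simp only [hx, norm_zero, mul_zero, mean_zero, Real.zero_rpow hc.ne']
  · rw [Real.norm_of_nonneg, mul_assoc, inv_mul_cancel₀ (norm_ne_zero_iff.2 hx), mul_one]
    exact mul_nonneg (Real.rpow_nonneg (mean_nonneg (norm_nonneg _) fun s _ => hg0 s) _)
      (inv_nonneg.2 (norm_nonneg _))

theorem continuous_mean_norm (hg : Continuous g) (hgC : ∀ s, |g s| ≤ C) :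
    Continuous fun x : EuclideanSpace ℝ (Fin N) => mean N g ‖x - x₀‖ := by
  refine ((continuous_mean_max (N := N) hg.measurable hgC).comp
    ((continuous_id.sub (continuous_const (y := x₀))).norm)).congr fun x => ?_
  simp

/-- The direction is singular at the centre, but the length is a positive power of a mean that tends
to zero there. -/
theorem continuous_radialGrad (hp : 1 < p) (hg : Continuous g) (hg0 : ∀ s, 0 ≤ g s)
    (hgC : ∀ s, |g s| ≤ C) : Continuous (radialGrad N p g x₀) := by
  have hc : 0 < 1 / (p - 1) := one_div_pos.2 (sub_pos.2 hp)
  have hm := (Real.continuous_rpow_const hc.le).comp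
    (continuous_mean_norm (N := N) (x₀ := x₀) hg hgC)
  refine continuous_iff_continuousAt.2 fun x => ?_
  rcases eq_or_ne x x₀ with rfl | hx
  · have h0 : radialGrad N p g x x = 0 := by simp [radialGrad]
    rw [ContinuousAt, h0, tendsto_zero_iff_norm_tendsto_zero]
    simp_rw [norm_radialGrad hp hg0]
    have := hm.tendsto x
    simpa [mean_zero, Real.zero_rpow, hc.ne', Function.comp_def, (sub_pos.2 hp).ne'] using this
  · have hx' : ‖x - x₀‖ ≠ 0 := norm_ne_zero_iff.2 (sub_ne_zero.2 hx)
    have h1 : ContinuousAt (fun x => ‖x - x₀‖) x := by fun_prop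
    exact ((hm.continuousAt.mul (h1.inv₀ hx')).neg).smul (by fun_prop)

theorem hasGradientAt_torsion (hp : 1 < p) (hρ : 0 ≤ ρ) (hg : Continuous g)
    (hgC : ∀ s, |g s| ≤ C) (x : EuclideanSpace ℝ (Fin N)) :
    HasGradientAt (fun x => torsion N p ρ g ‖x - x₀‖) (radialGrad N p g x₀ x) x := by
  have hc : 0 < 1 / (p - 1) := one_div_pos.2 (sub_pos.2 hp)
  set Q : ℝ → ℝ := fun θ => mean N g (max θ 0) ^ (1 / (p - 1)) with hQ
  have hQc : Continuous Q :=
    (Real.continuous_rpow_const hc.le).comp (continuous_mean_max hg.measurable hgC)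
  set V : ℝ → ℝ := fun r => ∫ θ in r..ρ, Q θ with hV
  have hV' : ∀ r, HasDerivAt V (-Q r) r := fun r => by
    have := (hQc.integral_hasStrictDerivAt ρ r).hasDerivAt.neg
    refine this.congr_of_eventuallyEq (.of_forall fun r => ?_)
    exact intervalIntegral.integral_symm _ _
  have hu : (fun x : EuclideanSpace ℝ (Fin N) => torsion N p ρ g ‖x - x₀‖) =
      fun x => V ‖x - x₀‖ := by
    ext x
    refine intervalIntegral.integral_congr fun θ hθ => ?_
    have : 0 ≤ θ := (le_min (norm_nonneg _) hρ).trans hθ.1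
    simp only [hQ, max_eq_left this, mean]
  rw [hu, hasGradientAt_iff_hasFDerivAt]
  rcases eq_or_ne x x₀ with rfl | hx
  · have hQ0 : Q 0 = 0 := by simp only [hQ, max_self, mean_zero, Real.zero_rpow hc.ne']
    have h0 : radialGrad N p g x x = 0 := by simp [radialGrad]
    rw [h0, map_zero]
    -- Since `V'(0) = 0`, the increment of `V` is `o(‖y - x‖)`, so the lack of differentiability of
    -- the norm at the centre does no harm.
    have h1 := hV' 0
    rw [hQ0, neg_zero, hasDerivAt_iff_isLittleO_nhds_zero] at h1
    rw [hasFDerivAt_iff_isLittleO]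
    have ht : Tendsto (fun y : EuclideanSpace ℝ (Fin N) => ‖y - x‖) (𝓝 x) (𝓝 0) := by
      have : Continuous fun y : EuclideanSpace ℝ (Fin N) => ‖y - x‖ := by fun_prop
      simpa using this.tendsto x
    have := h1.comp_tendsto ht
    simpa [Function.comp_def, Asymptotics.isLittleO_norm_right] using this
  · have hx' : x - x₀ ≠ 0 := sub_ne_zero.2 hx
    have hn : HasFDerivAt (fun y : EuclideanSpace ℝ (Fin N) => ‖y - x₀‖)
        (‖x - x₀‖⁻¹ • innerSL ℝ (x - x₀)) x := by
      have h1 : HasFDerivAt (fun y : EuclideanSpace ℝ (Fin N) => ‖y - x₀‖ ^ 2)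
          (2 • innerSL ℝ (x - x₀)) x := by
        have := (hasStrictFDerivAt_norm_sq (x - x₀)).hasFDerivAt.comp x
          ((hasFDerivAt_id x).sub_const x₀)
        simpa [Function.comp_def] using this
      have h2 := h1.sqrt (by simpa using hx')
      simp only [Real.sqrt_sq (norm_nonneg _)] at h2
      refine h2.congr_fderiv ?_
      ext y
      have : ‖x - x₀‖ ≠ 0 := norm_ne_zero_iff.2 hx'
      simp
      field_simp
    have h3 := (hV' ‖x - x₀‖).comp_hasFDerivAt x hn
    refine h3.congr_fderiv ?_
    ext y
    simp [radialGrad, hQ]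
    ring

theorem contDiff_torsion (hp : 1 < p) (hρ : 0 ≤ ρ) (hg : Continuous g) (hg0 : ∀ s, 0 ≤ g s)
    (hgC : ∀ s, |g s| ≤ C) :
    ContDiff ℝ 1 fun x : EuclideanSpace ℝ (Fin N) => torsion N p ρ g ‖x - x₀‖ := by
  rw [contDiff_one_iff_fderiv]
  have h := fun x => (hasGradientAt_torsion (x₀ := x₀) hp hρ hg hgC x).hasFDerivAt
  refine ⟨fun x => (h x).differentiableAt, ?_⟩
  rw [funext fun x => (h x).fderiv]
  exact (InnerProductSpace.toDual ℝ _).continuous.comp (continuous_radialGrad hp hg hg0 hgC)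

end Radial

/-! ### From radial profiles to weak solutions in the ball. -/

section WeakSolution

variable {N : ℕ} {g : ℝ → ℝ} {C p ρ : ℝ} {x₀ : EuclideanSpace ℝ (Fin N)}

theorem inner_gradient {η : EuclideanSpace ℝ (Fin N) → ℝ} (x v : EuclideanSpace ℝ (Fin N)) :
    inner ℝ v (gradient η x) = fderiv ℝ η x v := by
  rw [real_inner_comm, gradient, InnerProductSpace.toDual_symm_apply]

theorem continuous_gradient {η : EuclideanSpace ℝ (Fin N) → ℝ} (hη : ContDiff ℝ 1 η) :
    Continuous (gradient η) :=
  (InnerProductSpace.toDual ℝ _).symm.continuous.comp (hη.continuous_fderiv one_ne_zero)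

theorem gradient_eq_zero_of_notMem {η : EuclideanSpace ℝ (Fin N) → ℝ}
    {x : EuclideanSpace ℝ (Fin N)} (hx : x ∉ tsupport η) : gradient η x = 0 := by
  rw [gradient, fderiv_of_notMem_tsupport ℝ hx, map_zero]

theorem hasCompactSupport_gradient {η : EuclideanSpace ℝ (Fin N) → ℝ} (hη : HasCompactSupport η) :
    HasCompactSupport (gradient η) :=
  hη.mono' fun _ hx => by_contra fun h => hx (gradient_eq_zero_of_notMem h)

/-- Integration by parts for a `C¹` function against a `C¹` test function. -/
theorem integral_smul_gradient {u η : EuclideanSpace ℝ (Fin N) → ℝ} (hu : ContDiff ℝ 1 u)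
    (hη : ContDiff ℝ 1 η) (hη' : HasCompactSupport η) :
    ∫ x, u x • gradient η x = -∫ x, η x • gradient u x := by
  have i1 : Integrable fun x => u x • gradient η x :=
    (hu.continuous.smul (continuous_gradient hη)).integrable_of_hasCompactSupport
      (hasCompactSupport_gradient hη').smul_left
  have i2 : Integrable fun x => η x • gradient u x :=
    (hη.continuous.smul (continuous_gradient hu)).integrable_of_hasCompactSupport
      hη'.smul_right
  refine ext_inner_left ℝ fun v => ?_
  rw [inner_neg_right, ← integral_inner i1, ← integral_inner i2]
  have e1 : ∀ x, inner ℝ v (u x • gradient η x) = u x * fderiv ℝ η x v := fun x => by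
    rw [inner_smul_right, inner_gradient]
  have e2 : ∀ x, inner ℝ v (η x • gradient u x) = fderiv ℝ u x v * η x := fun x => by
    rw [inner_smul_right, inner_gradient, mul_comm]
  have i1' := i1.const_inner (𝕜 := ℝ) v
  have i2' := i2.const_inner (𝕜 := ℝ) v
  simp only [e1, e2] at i1' i2' ⊢
  exact integral_mul_fderiv_eq_neg_fderiv_mul_of_integrable i2' i1'
    ((hu.continuous.mul hη.continuous).integrable_of_hasCompactSupport hη'.mul_left)
    (fun x _ => hu.differentiable one_ne_zero x) (fun x _ => hη.differentiable one_ne_zero x)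

theorem setIntegral_eq_integral_of_tsupport {F : Type*} [NormedAddCommGroup F] [NormedSpace ℝ F]
    {D : Set (EuclideanSpace ℝ (Fin N))} {η : EuclideanSpace ℝ (Fin N) → ℝ}
    (hη : tsupport η ⊆ D) {f : EuclideanSpace ℝ (Fin N) → F}
    (hf : ∀ x ∉ tsupport η, f x = 0) : ∫ x in D, f x = ∫ x, f x :=
  setIntegral_eq_integral_of_forall_compl_eq_zero fun x hx => hf x fun h => hx (hη h)

theorem memLp_ball_of_continuous {F : Type*} [NormedAddCommGroup F]
    {f : EuclideanSpace ℝ (Fin N) → F} [SecondCountableTopology F] (hf : Continuous f)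
    (q : ENNReal) : MemLp f q (volume.restrict (ball x₀ ρ)) := by
  borelize F
  obtain ⟨K, hK⟩ := (isCompact_closedBall x₀ ρ).exists_bound_of_continuousOn hf.continuousOn
  have : IsFiniteMeasure (volume.restrict (ball x₀ ρ)) := ⟨by simp [measure_ball_lt_top]⟩
  refine MemLp.of_bound hf.aestronglyMeasurable K ?_
  filter_upwards [ae_restrict_mem measurableSet_ball] with x hx using hK x (ball_subset_closedBall hx)

/-- The flux of the radial field is `-b(|x - x₀|) (x - x₀) / |x - x₀|`. -/
theorem norm_rpow_mul_inner_radialGrad (hp : 1 < p) (hg0 : ∀ s, 0 ≤ g s)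
    (η : EuclideanSpace ℝ (Fin N) → ℝ) (x : EuclideanSpace ℝ (Fin N)) :
    ‖radialGrad N p g x₀ x‖ ^ (p - 2) * inner ℝ (radialGrad N p g x₀ x) (gradient η x) =
      -(mean N g ‖x - x₀‖ * ‖x - x₀‖⁻¹ * fderiv ℝ η x (x - x₀)) := by
  have hc : 0 < 1 / (p - 1) := one_div_pos.2 (sub_pos.2 hp)
  set m := mean N g ‖x - x₀‖ with hm
  have hm0 : 0 ≤ m := mean_nonneg (norm_nonneg _) fun s _ => hg0 s
  -- The exponents add up to `1`. The case `m = 0` is separate because `p - 2` may be negative.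
  have key : (m ^ (1 / (p - 1))) ^ (p - 2) * m ^ (1 / (p - 1)) = m := by
    rcases hm0.eq_or_lt with h | h
    · rw [← h, Real.zero_rpow hc.ne', mul_zero]
    · rw [← Real.rpow_mul h.le, ← Real.rpow_add h]
      have : 1 / (p - 1) * (p - 2) + 1 / (p - 1) = 1 := by
        have : p - 1 ≠ 0 := (sub_pos.2 hp).ne'
        field_simp
        ring
      rw [this, Real.rpow_one]
  rw [norm_radialGrad hp hg0, inner_gradient, radialGrad, map_smul, smul_eq_mul, ← hm]
  calc _ = -((m ^ (1 / (p - 1))) ^ (p - 2) * m ^ (1 / (p - 1)) *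
        ‖x - x₀‖⁻¹ * fderiv ℝ η x (x - x₀)) := by ring
    _ = _ := by rw [key]

theorem integral_flux (hN : 2 ≤ N) (hp : 1 < p) (hg : Continuous g) (hg0 : ∀ s, 0 ≤ g s)
    (hgC : ∀ s, |g s| ≤ C) {η : EuclideanSpace ℝ (Fin N) → ℝ} (hη : ContDiff ℝ 1 η)
    (hη' : HasCompactSupport η) :
    ∫ x, ‖radialGrad N p g x₀ x‖ ^ (p - 2) * inner ℝ (radialGrad N p g x₀ x) (gradient η x) =
      ∫ x, g ‖x - x₀‖ * η x := by
  simp only [norm_rpow_mul_inner_radialGrad hp hg0]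
  have hη₀ : ContDiff ℝ 1 fun x => η (x + x₀) := hη.comp (contDiff_id.add contDiff_const)
  have hη₀' : HasCompactSupport fun x => η (x + x₀) :=
    hη'.comp_homeomorph (Homeomorph.addRight x₀)
  have h := (integral_mean_mul_fderiv hN hg hgC hη₀ hη₀').2.2
  rw [← integral_sub_right_eq_self _ x₀,
    ← integral_sub_right_eq_self (fun x => g ‖x‖ * η (x + x₀)) x₀] at h
  simp only [fderiv_comp_add_right, sub_add_cancel] at h
  rw [integral_neg, h, neg_neg]

theorem gradient_eq_radialGrad (hp : 1 < p) (hρ : 0 ≤ ρ) (hg : Continuous g)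
    (hgC : ∀ s, |g s| ≤ C) {u : EuclideanSpace ℝ (Fin N) → ℝ}
    (hu : ∀ x ∈ closedBall x₀ ρ, u x = torsion N p ρ g ‖x - x₀‖) {x : EuclideanSpace ℝ (Fin N)}
    (hx : x ∈ ball x₀ ρ) : gradient u x = radialGrad N p g x₀ x := by
  refine HasGradientAt.gradient ?_
  refine (hasGradientAt_torsion hp hρ hg hgC x).congr_of_eventuallyEq ?_
  filter_upwards [isOpen_ball.mem_nhds hx] with y hy using hu y (ball_subset_closedBall hy)

/-- The right-hand side enters only through its values along `u`, so one statement covers both the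
torsion problem and the nonlinear one. Agreement with the torsion profile on the closed ball is
enough, since test functions are supported inside. -/
theorem isWeakSolution_radial (hN : 2 ≤ N) (hp : 1 < p) (hρ : 0 < ρ) (hg : Continuous g)
    (hg0 : ∀ s, 0 ≤ g s) (hgC : ∀ s, |g s| ≤ C) {u : EuclideanSpace ℝ (Fin N) → ℝ}
    (hu : ∀ x ∈ closedBall x₀ ρ, u x = torsion N p ρ g ‖x - x₀‖)
    {F : EuclideanSpace ℝ (Fin N) → ℝ → EuclideanSpace ℝ (Fin N) → ℝ}
    (hF : ∀ x ∈ ball x₀ ρ, F x (u x) (gradient u x) = g ‖x - x₀‖) :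
    IsWeakSolution p (ball x₀ ρ) F u (gradient u) := by
  set U : EuclideanSpace ℝ (Fin N) → ℝ := fun x => torsion N p ρ g ‖x - x₀‖ with hU
  have hU1 : ContDiff ℝ 1 U := contDiff_torsion hp hρ.le hg hg0 hgC
  have huU : ∀ x ∈ ball x₀ ρ, u x = U x := fun x hx => hu x (ball_subset_closedBall hx)
  have hgr : ∀ x ∈ ball x₀ ρ, gradient u x = radialGrad N p g x₀ x := fun x hx =>
    gradient_eq_radialGrad hp hρ.le hg hgC hu hx
  have hgU : gradient U = radialGrad N p g x₀ := funext fun x =>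
    (hasGradientAt_torsion hp hρ.le hg hgC x).gradient
  have hGc : Continuous (radialGrad N p g x₀) := continuous_radialGrad hp hg hg0 hgC
  have hae : ∀ {P : EuclideanSpace ℝ (Fin N) → Prop}, (∀ x ∈ ball x₀ ρ, P x) →
      ∀ᵐ x ∂(volume.restrict (ball x₀ ρ)), P x := fun h => by
    filter_upwards [ae_restrict_mem measurableSet_ball] with x hx using h x hx
  have hgη : ∀ η, IsTest (ball x₀ ρ) η → Integrable fun x => g ‖x - x₀‖ * η x := fun η hη =>
    Continuous.integrable_of_hasCompactSupport
      ((hg.comp (continuous_id.sub continuous_const).norm).mul hη.smooth.continuous)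
      hη.compact.mul_left
  refine ⟨⟨?_, ?_, fun η hη => ?_⟩, ?_, ?_, fun x hx => ?_, fun η hη => ?_, fun η hη => ?_⟩
  · exact (memLp_congr_ae (hae huU)).2 (memLp_ball_of_continuous hU1.continuous _)
  · exact (memLp_congr_ae (hae hgr)).2 (memLp_ball_of_continuous hGc _)
  · have hη1 : ContDiff ℝ 1 η := hη.smooth.of_le (by exact_mod_cast le_top)
    have h := integral_smul_gradient hU1 hη1 hη.compact
    rw [hgU] at h
    have e1 : ∫ x in ball x₀ ρ, u x • gradient η x = ∫ x, U x • gradient η x :=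
      (setIntegral_congr_fun measurableSet_ball fun x hx => by simp only [huU x hx]).trans
        (setIntegral_eq_integral_of_tsupport hη.supp fun x hx => by
          rw [gradient_eq_zero_of_notMem hx, smul_zero])
    have e2 : ∫ x in ball x₀ ρ, η x • gradient u x = ∫ x, η x • radialGrad N p g x₀ x :=
      (setIntegral_congr_fun measurableSet_ball fun x hx => by simp only [hgr x hx]).trans
        (setIntegral_eq_integral_of_tsupport hη.supp fun x hx => by
          rw [image_eq_zero_of_notMem_tsupport hx, zero_smul])
    rw [e1, e2, h]
  · exact (memLp_congr_ae (hae huU)).2 (memLp_ball_of_continuous hU1.continuous _)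
  · rw [closure_ball x₀ hρ.ne']
    exact hU1.continuous.continuousOn.congr hu
  · rw [frontier_ball x₀ hρ.ne'] at hx
    rw [hu x (sphere_subset_closedBall hx), ← dist_eq_norm, mem_sphere.1 hx]
    simp [torsion]
  · refine (hgη η hη).integrableOn.congr_fun (fun x hx => ?_) measurableSet_ball
    simp only [hF x hx]
  · have hη1 : ContDiff ℝ 1 η := hη.smooth.of_le (by exact_mod_cast le_top)
    have e1 : ∫ x in ball x₀ ρ, ‖gradient u x‖ ^ (p - 2) * inner ℝ (gradient u x) (gradient η x) =
        ∫ x, ‖radialGrad N p g x₀ x‖ ^ (p - 2) *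
          inner ℝ (radialGrad N p g x₀ x) (gradient η x) :=
      (setIntegral_congr_fun measurableSet_ball fun x hx => by simp only [hgr x hx]).trans
        (setIntegral_eq_integral_of_tsupport hη.supp fun x hx => by
          rw [gradient_eq_zero_of_notMem hx, inner_zero_right, mul_zero])
    have e2 : ∫ x in ball x₀ ρ, F x (u x) (gradient u x) * η x = ∫ x, g ‖x - x₀‖ * η x :=
      (setIntegral_congr_fun measurableSet_ball fun x hx => by simp only [hF x hx]).trans
        (setIntegral_eq_integral_of_tsupport hη.supp fun x hx => by
          rw [image_eq_zero_of_notMem_tsupport hx, mul_zero])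
    rw [e1, e2, integral_flux hN hp hg hg0 hgC hη1 hη.compact]

end WeakSolution

/-! ### The constants `k₁`, `k₂`, `γ_ρ` and the upper barriers. -/

section Constants

variable {N : ℕ} {w : ℝ → ℝ} {C p ρ t : ℝ}

theorem oddPow_conj (hp : 1 < p) {ξ : ℝ} (hξ : 0 ≤ ξ) :
    oddPow (conj p) ξ = ξ ^ (1 / (p - 1)) := by
  have hp' : p - 1 ≠ 0 := (sub_pos.2 hp).ne'
  rcases hξ.eq_or_lt with rfl | h
  · rw [oddPow, mul_zero, Real.zero_rpow (one_div_ne_zero hp')]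
  · rw [oddPow, abs_of_pos h, conj]
    nth_rw 2 [← Real.rpow_one ξ]
    rw [← Real.rpow_add h]
    congr 1
    field_simp
    ring

theorem rpow_rpow_one_div (hp : 1 < p) {x : ℝ} (hx : 0 ≤ x) :
    (x ^ (p - 1)) ^ (1 / (p - 1)) = x := by
  rw [one_div, Real.rpow_rpow_inv hx (sub_pos.2 hp).ne']

/-- The normalisation behind both `k₁` and `k₂`: the power `1 / (p - 1)` of the constant is the
inverse of the maximum that defines it. -/
theorem rpow_neg_rpow_one_div_mul (hp : 1 < p) {x : ℝ} (hx : 0 < x) :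
    (x ^ (-(p - 1))) ^ (1 / (p - 1)) * x = 1 := by
  rw [Real.rpow_neg hx.le, Real.inv_rpow (Real.rpow_nonneg hx.le _), rpow_rpow_one_div hp hx.le,
    inv_mul_cancel₀ hx.ne']

theorem integral_kernel_eq {r θ : ℝ} (hθ : 0 < θ) :
    ∫ s in (0 : ℝ)..r, kernel N w s θ =
      (θ ^ (N - 1))⁻¹ * ∫ s in (0 : ℝ)..r, s ^ (N - 1) * w s := by
  rw [← intervalIntegral.integral_const_mul]
  congr 1 with s
  rw [kernel, div_pow]
  field_simp

theorem integral_kernel_nonneg (hw0 : ∀ s, 0 ≤ w s) {r θ : ℝ} (hr : 0 ≤ r) (hθ : 0 ≤ θ) :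
    0 ≤ ∫ s in (0 : ℝ)..r, kernel N w s θ :=
  intervalIntegral.integral_nonneg hr fun s hs => kernel_nonneg hs.1 hθ (hw0 s)

theorem exists_pos_mem_Ioo (hρ : 0 < ρ) (hw : Continuous w) (hw0 : ∀ s, 0 ≤ w s)
    (hne : ∃ s ∈ Icc 0 ρ, w s ≠ 0) : ∃ s ∈ Ioo 0 ρ, 0 < w s := by
  obtain ⟨s, hs, hws⟩ := hne
  rw [← closure_Ioo hρ.ne] at hs
  obtain ⟨s', h1, h2⟩ := mem_closure_iff.1 hs {s | 0 < w s} (isOpen_lt continuous_const hw)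
    ((hw0 s).lt_of_ne' hws)
  exact ⟨s', h2, h1⟩

theorem integral_pow_mul_pos (hw : Continuous w) (hw0 : ∀ s, 0 ≤ w s) {s r : ℝ} (hs : 0 < s)
    (hws : 0 < w s) (hr : s ≤ r) : 0 < ∫ s in (0 : ℝ)..r, s ^ (N - 1) * w s :=
  intervalIntegral.integral_pos (hs.trans_le hr) (by fun_prop)
    (fun x hx => mul_nonneg (pow_nonneg hx.1.le _) (hw0 x))
    ⟨s, ⟨hs.le, hr⟩, mul_pos (pow_pos hs _) hws⟩

theorem continuousOn_integral_kernel {r : ℝ} (hr : 0 < r) :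
    ContinuousOn (fun θ => ∫ s in (0 : ℝ)..r, kernel N w s θ) (Icc r ρ) := by
  refine ContinuousOn.congr (f := fun θ => (θ ^ (N - 1))⁻¹ *
    ∫ s in (0 : ℝ)..r, s ^ (N - 1) * w s) ?_ fun θ hθ => integral_kernel_eq (hr.trans_le hθ.1)
  refine ContinuousOn.mul (ContinuousOn.inv₀ (by fun_prop) fun θ hθ => ?_) continuousOn_const
  exact (pow_pos (hr.trans_le hθ.1) _).ne'

theorem k₂Aux_zero (hp : 1 < p) : k₂Aux N p ρ w 0 = 0 := by
  have hc : 1 / (p - 1) ≠ 0 := (one_div_pos.2 (sub_pos.2 hp)).ne'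
  simp only [k₂Aux, intervalIntegral.integral_same, Real.zero_rpow hc]
  simp

/-- The maximum dominates the value at an interior point `s` with `w s > 0`, where the inner
integral is already positive. -/
theorem k₂Aux_pos (hp : 1 < p) (hρ : 0 < ρ) (hw : Continuous w) (hw0 : ∀ s, 0 ≤ w s)
    (hne : ∃ s ∈ Icc 0 ρ, w s ≠ 0) (ht : IsMaxOn (k₂Aux N p ρ w) (Icc 0 ρ) t) :
    0 < k₂Aux N p ρ w t := by
  have hc : 0 < 1 / (p - 1) := one_div_pos.2 (sub_pos.2 hp)
  obtain ⟨s, hs, hws⟩ := exists_pos_mem_Ioo hρ hw hw0 hne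
  refine lt_of_lt_of_le ?_ (ht ⟨hs.1.le, hs.2.le⟩)
  refine intervalIntegral.integral_pos hs.2
    ((Real.continuous_rpow_const hc.le).comp_continuousOn (continuousOn_integral_kernel hs.1))
    (fun θ hθ => Real.rpow_nonneg
      (integral_kernel_nonneg hw0 hs.1.le (hs.1.trans hθ.1).le) _)
    ⟨ρ, ⟨hs.2.le, le_rfl⟩, Real.rpow_pos_of_pos ?_ _⟩
  rw [integral_kernel_eq hρ]
  exact mul_pos (inv_pos.2 (pow_pos hρ _)) (integral_pow_mul_pos hw hw0 hs.1 hws le_rfl)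

/-- `k₂Aux` vanishes at both ends: the inner integral is empty at `0`, the outer one at `ρ`. -/
theorem mem_Ioo_of_isMaxOn_k₂Aux (hp : 1 < p) (ht : t ∈ Icc 0 ρ) (hpos : 0 < k₂Aux N p ρ w t) :
    t ∈ Ioo 0 ρ := by
  refine ⟨ht.1.lt_of_ne ?_, ht.2.lt_of_ne ?_⟩
  · rintro rfl
    exact hpos.ne' (k₂Aux_zero hp)
  · rintro rfl
    simp [k₂Aux] at hpos

theorem integral_pow_mul_pos_of_k₂Aux_pos (hp : 1 < p) (hw0 : ∀ s, 0 ≤ w s) (ht : t ∈ Ioo 0 ρ)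
    (hpos : 0 < k₂Aux N p ρ w t) : 0 < ∫ s in (0 : ℝ)..t, s ^ (N - 1) * w s := by
  have hc : 1 / (p - 1) ≠ 0 := (one_div_pos.2 (sub_pos.2 hp)).ne'
  refine (intervalIntegral.integral_nonneg ht.1.le fun s hs =>
    mul_nonneg (pow_nonneg hs.1 _) (hw0 s)).lt_of_ne fun h => hpos.ne' ?_
  rw [k₂Aux, intervalIntegral.integral_congr (g := fun _ => (0 : ℝ)) fun θ hθ => ?_]
  · simp
  · rw [uIcc_of_le ht.2.le] at hθ
    simp only [integral_kernel_eq (ht.1.trans_le hθ.1), ← h, mul_zero, Real.zero_rpow hc]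

theorem k₂_eq (ht : t ∈ Icc 0 ρ) (hmax : IsMaxOn (k₂Aux N p ρ w) (Icc 0 ρ) t) :
    k₂ N p ρ w = k₂Aux N p ρ w t ^ (-(p - 1)) := by
  have : IsGreatest (k₂Aux N p ρ w '' Icc 0 ρ) (k₂Aux N p ρ w t) :=
    ⟨mem_image_of_mem _ ht, forall_mem_image.2 hmax⟩
  rw [k₂, this.csSup_eq, neg_sub]

theorem torsion_eq {g : ℝ → ℝ} {r : ℝ} :
    torsion N p ρ g r = ∫ θ in r..ρ, mean N g θ ^ (1 / (p - 1)) := rfl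

theorem intervalIntegrable_mean_rpow (hp : 1 < p) (hw : Measurable w) (hwC : ∀ s, |w s| ≤ C)
    {a b : ℝ} (ha : 0 ≤ a) (hab : a ≤ b) :
    IntervalIntegrable (fun θ => mean N w θ ^ (1 / (p - 1))) volume a b := by
  have hc : 0 < 1 / (p - 1) := one_div_pos.2 (sub_pos.2 hp)
  refine ContinuousOn.intervalIntegrable_of_Icc hab ?_
  exact (Real.continuous_rpow_const hc.le).comp_continuousOn
    ((continuousOn_mean hw hwC (ha.trans hab)).mono (Icc_subset_Icc_left ha))

theorem torsion_nonneg (hw0 : ∀ s, 0 ≤ w s) {r : ℝ} (hr : r ∈ Icc 0 ρ) :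
    0 ≤ torsion N p ρ w r :=
  intervalIntegral.integral_nonneg hr.2 fun _ hθ =>
    Real.rpow_nonneg (mean_nonneg (hr.1.trans hθ.1) fun s _ => hw0 s) _

theorem torsion_le_torsion_zero (hp : 1 < p) (hw : Measurable w) (hw0 : ∀ s, 0 ≤ w s)
    (hwC : ∀ s, |w s| ≤ C) {r : ℝ} (hr : r ∈ Icc 0 ρ) :
    torsion N p ρ w r ≤ torsion N p ρ w 0 := by
  rw [torsion_eq, torsion_eq, ← intervalIntegral.integral_add_adjacent_intervals
    (intervalIntegrable_mean_rpow hp hw hwC le_rfl hr.1)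
    (intervalIntegrable_mean_rpow hp hw hwC hr.1 hr.2)]
  exact le_add_of_nonneg_left (intervalIntegral.integral_nonneg hr.1 fun _ hθ =>
    Real.rpow_nonneg (mean_nonneg hθ.1 fun s _ => hw0 s) _)

theorem torsion_zero_pos (hp : 1 < p) (hρ : 0 < ρ) (hw : Continuous w) (hw0 : ∀ s, 0 ≤ w s)
    (hwC : ∀ s, |w s| ≤ C) (hne : ∃ s ∈ Icc 0 ρ, w s ≠ 0) : 0 < torsion N p ρ w 0 := by
  have hc : 0 < 1 / (p - 1) := one_div_pos.2 (sub_pos.2 hp)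
  obtain ⟨s, hs, hws⟩ := exists_pos_mem_Ioo hρ hw hw0 hne
  refine intervalIntegral.integral_pos hρ ?_
    (fun θ hθ => Real.rpow_nonneg (mean_nonneg hθ.1.le fun s _ => hw0 s) _)
    ⟨ρ, ⟨hρ.le, le_rfl⟩, Real.rpow_pos_of_pos ?_ _⟩
  · exact (Real.continuous_rpow_const hc.le).comp_continuousOn
      (continuousOn_mean (N := N) hw.measurable hwC hρ.le)
  · rw [integral_kernel_eq hρ]
    exact mul_pos (inv_pos.2 (pow_pos hρ _)) (integral_pow_mul_pos hw hw0 hs.1 hws hs.2.le)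

/-- The torsion profile is nonnegative and decreases away from the centre, so its supremum is its
value at `0`. -/
theorem k₁_eq (hp : 1 < p) (hρ : 0 ≤ ρ) (hw : Measurable w) (hw0 : ∀ s, 0 ≤ w s)
    (hwC : ∀ s, |w s| ≤ C) : k₁ N p ρ w = torsion N p ρ w 0 ^ (-(p - 1)) := by
  have : IsGreatest ((fun r => |torsion N p ρ w r|) '' Icc 0 ρ) (torsion N p ρ w 0) := by
    have h0 : (0 : ℝ) ∈ Icc 0 ρ := ⟨le_rfl, hρ⟩
    refine ⟨⟨0, h0, abs_of_nonneg (torsion_nonneg hw0 h0)⟩, forall_mem_image.2 fun r hr => ?_⟩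
    rw [abs_of_nonneg (torsion_nonneg hw0 hr)]
    exact torsion_le_torsion_zero hp hw hw0 hwC hr
  rw [k₁, this.csSup_eq]

theorem k₁_nonneg : 0 ≤ k₁ N p ρ w :=
  Real.rpow_nonneg (Real.sSup_nonneg (forall_mem_image.2 fun _ _ => abs_nonneg _)) _

theorem Gam_eq (hp : 1 < p) (hw0 : ∀ s, 0 ≤ w s) {M r : ℝ} (hr : 0 ≤ r) :
    Gam N p ρ w M r = M * (k₁ N p ρ w * mean N w r) ^ (1 / (p - 1)) := by
  rw [Gam, oddPow_conj hp (mul_nonneg k₁_nonneg (integral_kernel_nonneg hw0 hr hr))]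
  rfl

theorem Gam_le (hp : 1 < p) (hρ : 0 ≤ ρ) (hw : Measurable w) (hw0 : ∀ s, 0 ≤ w s)
    (hwC : ∀ s, |w s| ≤ C) {M r : ℝ} (hM : 0 ≤ M) (hr : r ∈ Icc 0 ρ) :
    Gam N p ρ w M r ≤ gam N p ρ w * M := by
  have hc : 0 < 1 / (p - 1) := one_div_pos.2 (sub_pos.2 hp)
  rw [Gam, mul_comm]
  refine mul_le_mul_of_nonneg_right (le_csSup ?_ (mem_image_of_mem _ hr)) hM
  refine IsCompact.bddAbove_image isCompact_Icc ?_
  refine ContinuousOn.congr (f := fun r => (k₁ N p ρ w * mean N w r) ^ (1 / (p - 1)))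
    ((Real.continuous_rpow_const hc.le).comp_continuousOn
      (continuousOn_const.mul (continuousOn_mean hw hwC hρ))) fun r hr => ?_
  exact oddPow_conj hp (mul_nonneg k₁_nonneg (integral_kernel_nonneg hw0 hr.1 hr.1))

theorem Phi_eq {M r : ℝ} :
    Phi N p ρ w M r = ∫ θ in r..ρ, Gam N p ρ w M θ := by
  rw [Phi, ← intervalIntegral.integral_const_mul]
  rfl

/-- `Phi` is `M` times the torsion profile divided by its maximum. -/
theorem Phi_le (hp : 1 < p) (hρ : 0 < ρ) (hw : Continuous w) (hw0 : ∀ s, 0 ≤ w s)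
    (hwC : ∀ s, |w s| ≤ C) (hne : ∃ s ∈ Icc 0 ρ, w s ≠ 0) {M r : ℝ} (hM : 0 ≤ M)
    (hr : r ∈ Icc 0 ρ) : Phi N p ρ w M r ≤ M := by
  have h : Phi N p ρ w M r = M * (k₁ N p ρ w ^ (1 / (p - 1)) * torsion N p ρ w r) := by
    rw [Phi, torsion_eq]
    congr 1
    rw [← intervalIntegral.integral_const_mul]
    refine intervalIntegral.integral_congr fun θ hθ => ?_
    rw [uIcc_of_le hr.2] at hθ
    have hθ0 : 0 ≤ θ := hr.1.trans hθ.1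
    rw [oddPow_conj hp (mul_nonneg k₁_nonneg (integral_kernel_nonneg hw0 hθ0 hθ0)),
      Real.mul_rpow k₁_nonneg (integral_kernel_nonneg hw0 hθ0 hθ0), mean]
  have hpos := torsion_zero_pos (N := N) hp hρ hw hw0 hwC hne
  rw [h]
  refine mul_le_of_le_one_right hM ?_
  calc _ ≤ k₁ N p ρ w ^ (1 / (p - 1)) * torsion N p ρ w 0 :=
        mul_le_mul_of_nonneg_left (torsion_le_torsion_zero hp hw.measurable hw0 hwC hr)
          (Real.rpow_nonneg k₁_nonneg _)
    _ = 1 := by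
        rw [k₁_eq hp hρ.le hw.measurable hw0 hwC, rpow_neg_rpow_one_div_mul hp hpos]

end Constants

/-! ### The truncated problem and its barriers. -/

section Profile

variable {N : ℕ} {w : ℝ → ℝ} {C p ρ t δ M : ℝ} {f : ℝ → ℝ → ℝ}

theorem Psi_of_lt {r : ℝ} (hp : 1 < p) (hw0 : ∀ s, 0 ≤ w s) (hk : 0 ≤ k₂ N p ρ w) (ht : 0 ≤ t)
    (htr : t < r) (hr : r ≤ ρ) :
    Psi N p ρ w t δ r = ∫ θ in r..ρ,
      δ * (k₂ N p ρ w * ∫ s in (0 : ℝ)..t, kernel N w s θ) ^ (1 / (p - 1)) := by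
  rw [Psi, if_neg htr.not_ge, ← intervalIntegral.integral_const_mul]
  refine intervalIntegral.integral_congr fun θ hθ => ?_
  rw [uIcc_of_le hr] at hθ
  rw [oddPow_conj hp (mul_nonneg hk
    (integral_kernel_nonneg hw0 ht (ht.trans (htr.le.trans hθ.1))))]

theorem Psi_pos (hp : 1 < p) (hw0 : ∀ s, 0 ≤ w s) (hk : 0 < k₂ N p ρ w) (ht : t ∈ Ioo 0 ρ)
    (hI : 0 < ∫ s in (0 : ℝ)..t, s ^ (N - 1) * w s) (hδ : 0 < δ) {r : ℝ} (hr : r < ρ) :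
    0 < Psi N p ρ w t δ r := by
  have hc : 0 < 1 / (p - 1) := one_div_pos.2 (sub_pos.2 hp)
  rcases le_or_gt r t with h | h
  · rwa [Psi, if_pos h]
  have hcont : ContinuousOn (fun θ => δ *
      (k₂ N p ρ w * ∫ s in (0 : ℝ)..t, kernel N w s θ) ^ (1 / (p - 1))) (Icc r ρ) :=
    continuousOn_const.mul ((Real.continuous_rpow_const hc.le).comp_continuousOn
      (continuousOn_const.mul
        ((continuousOn_integral_kernel ht.1).mono (Icc_subset_Icc_left h.le))))
  rw [Psi_of_lt hp hw0 hk.le ht.1.le h hr.le]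
  refine intervalIntegral.intervalIntegral_pos_of_pos_on
    (hcont.intervalIntegrable_of_Icc hr.le) (fun θ hθ => ?_) hr
  rw [integral_kernel_eq (ht.1.trans (h.trans hθ.1))]
  have : 0 < θ := ht.1.trans (h.trans hθ.1)
  positivity

/-- Existence of the radial profile between the barriers, in terms of the right-hand side `G` of
the resulting equation. -/
theorem exists_source (hp : 1 < p) (hρ : 0 < ρ) (hw : Continuous w) (hw0 : ∀ s, 0 ≤ w s)
    (hwC : ∀ s, |w s| ≤ C) (hne : ∃ s ∈ Icc 0 ρ, w s ≠ 0) (ht : t ∈ Icc 0 ρ)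
    (hmax : IsMaxOn (k₂Aux N p ρ w) (Icc 0 ρ) t)
    (hf : ContinuousOn (Function.uncurry f) (Ici 0 ×ˢ Ici 0)) (hδ : 0 < δ) (hδM : δ < M)
    (H1 : ∀ u z : ℝ, 0 ≤ u → u ≤ M → 0 ≤ z → z ≤ gam N p ρ w * M →
      0 ≤ f u z ∧ f u z ≤ k₁ N p ρ w * M ^ (p - 1))
    (H2 : ∀ u z : ℝ, δ ≤ u → u ≤ M → 0 ≤ z → z ≤ gam N p ρ w * M →
      k₂ N p ρ w * δ ^ (p - 1) ≤ f u z) :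
    ∃ (G : ℝ → ℝ) (C' : ℝ), Continuous G ∧ (∀ s, 0 ≤ G s) ∧ (∀ s, |G s| ≤ C') ∧
      ∀ r ∈ Icc 0 ρ, G r = w r * f (torsion N p ρ G r) (mean N G r ^ (1 / (p - 1))) ∧
        Psi N p ρ w t δ r ≤ torsion N p ρ G r ∧ torsion N p ρ G r ≤ Phi N p ρ w M r ∧
        mean N G r ^ (1 / (p - 1)) ≤ Gam N p ρ w M r := by
  set c := 1 / (p - 1) with hcdef
  have hc : 0 < c := one_div_pos.2 (sub_pos.2 hp)
  have hM : 0 < M := hδ.trans hδM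
  have hC : 0 ≤ C := (abs_nonneg _).trans (hwC 0)
  have hapos := k₂Aux_pos (N := N) hp hρ hw hw0 hne hmax
  have ht' := mem_Ioo_of_isMaxOn_k₂Aux hp ht hapos
  have hk₂e := k₂_eq ht hmax
  have hk₂ : 0 < k₂ N p ρ w := by rw [hk₂e]; exact Real.rpow_pos_of_pos hapos _
  have hk₁ : 0 ≤ k₁ N p ρ w := k₁_nonneg
  set Γ := gam N p ρ w * M with hΓ
  set κ := k₁ N p ρ w * M ^ (p - 1) with hκ
  have hκ0 : 0 ≤ κ := mul_nonneg hk₁ (Real.rpow_nonneg hM.le _)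
  have hGam0 : ∀ r, 0 ≤ r → 0 ≤ Gam N p ρ w M r := fun r hr => by
    rw [Gam_eq hp hw0 hr]
    exact mul_nonneg hM.le (Real.rpow_nonneg (mul_nonneg hk₁ (mean_nonneg hr fun s _ => hw0 s)) _)
  have hΓ0 : 0 ≤ Γ := (hGam0 0 le_rfl).trans
    (Gam_le hp hρ.le hw.measurable hw0 hwC hM.le ⟨le_rfl, hρ.le⟩)
  -- the truncated nonlinearity
  set F : ℝ × ℝ → ℝ := fun y => f (max 0 y.1) (max 0 y.2) with hF
  have hFc : Continuous F := by
    refine hf.comp_continuous (f := fun y : ℝ × ℝ => (max 0 y.1, max 0 y.2)) (by fun_prop)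
      fun y => ⟨mem_Ici.2 (le_max_left _ _), mem_Ici.2 (le_max_left _ _)⟩
  -- Lower cut-off for the first argument of `f`: the level `δ` on `[0, t]` makes `H2` available
  -- there before `v ≥ δ` is known. The jump at `t` is only in the variable `s`.
  set L : ℝ → ℝ := fun s => if s ≤ t then δ else 0 with hL
  have hLm : Measurable L := Measurable.ite measurableSet_Iic measurable_const measurable_const
  have hL0 : ∀ s, 0 ≤ L s := fun s => by simp only [hL]; split_ifs <;> linarith
  have hLM : ∀ s, L s ≤ M := fun s => by simp only [hL]; split_ifs <;> linarith
  set h : ℝ → ℝ → ℝ → ℝ := fun s u z => w s * F (max (L s) (min u M), min z Γ) with hh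
  have hFh : ∀ s u z, F (max (L s) (min u M), min z Γ) =
      f (max (L s) (min u M)) (max 0 (min z Γ)) := fun s u z => by
    simp only [hF]
    rw [max_eq_right ((hL0 s).trans (le_max_left _ _))]
  have hFb : ∀ s u z, 0 ≤ F (max (L s) (min u M), min z Γ) ∧
      F (max (L s) (min u M), min z Γ) ≤ κ := fun s u z => by
    rw [hFh]
    exact H1 _ _ ((hL0 s).trans (le_max_left _ _)) (max_le (hLM s) (min_le_right _ _))
      (le_max_left _ _) (max_le hΓ0 (min_le_right _ _))
  have hm : Measurable fun x : ℝ × ℝ × ℝ => h x.1 x.2.1 x.2.2 := by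
    have h1 : Measurable fun x : ℝ × ℝ × ℝ => L x.1 := hLm.comp measurable_fst
    refine (hw.measurable.comp measurable_fst).mul (hFc.measurable.comp ?_)
    fun_prop
  have hcont : ∀ s, Continuous fun y : ℝ × ℝ => h s y.1 y.2 := fun s => by
    refine continuous_const.mul (hFc.comp ?_)
    fun_prop
  have hb0 : ∀ s u z, 0 ≤ h s u z := fun s u z => mul_nonneg (hw0 s) (hFb s u z).1
  have hbw : ∀ s u z, h s u z ≤ κ * w s := fun s u z => by
    rw [mul_comm κ]
    exact mul_le_mul_of_nonneg_left (hFb s u z).2 (hw0 s)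
  have hwκC : ∀ s, |κ * w s| ≤ κ * C := fun s => by
    rw [abs_mul, abs_of_nonneg hκ0]
    exact mul_le_mul_of_nonneg_left (hwC s) hκ0
  have hb : ∀ s u z, |h s u z| ≤ κ * C := fun s u z => by
    rw [abs_of_nonneg (hb0 s u z)]
    exact (hbw s u z).trans ((le_abs_self _).trans (hwκC s))
  obtain ⟨b, hbc, hbn, hbe⟩ := exists_radial_profile (N := N) hm hcont hb0 hb hc.le hρ.le
  set α := ∫ τ in (0 : ℝ)..ρ, b τ ^ c with hα
  set S := source h c α b with hS
  have hSm : Measurable S := measurable_source hm hc.le α hbc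
  have hSC : ∀ s, |S s| ≤ κ * C := fun s => hb _ _ _
  have hQc : Continuous fun θ => b θ ^ c := continuous_rpow_comp hc.le hbc
  set v : ℝ → ℝ := fun r => ∫ θ in r..ρ, b θ ^ c with hv
  have hvα : ∀ s, α - ∫ τ in (0 : ℝ)..s, b τ ^ c = v s := fun s => by
    rw [hα, intervalIntegral.integral_interval_sub_left (hQc.intervalIntegrable _ _)
      (hQc.intervalIntegrable _ _)]
  have hSv : ∀ s, S s = w s * F (max (L s) (min (v s) M), min (b s ^ c) Γ) := fun s => by
    rw [hS, source, hvα]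
  have hQ0 : ∀ θ, 0 ≤ b θ ^ c := fun θ => Real.rpow_nonneg (hbn θ) _
  have hv0 : ∀ r ≤ ρ, 0 ≤ v r := fun r hr =>
    intervalIntegral.integral_nonneg hr fun θ _ => hQ0 θ
  have hvc : Continuous v := by
    have : v = fun s => α - ∫ τ in (0 : ℝ)..s, b τ ^ c := funext fun s => (hvα s).symm
    rw [this]
    exact continuous_const.sub (continuous_primitive_rpow hc.le hbc)
  -- upper barrier
  have hQΓ : ∀ r ∈ Icc 0 ρ, b r ^ c ≤ Gam N p ρ w M r := fun r hr => by
    -- The truncated source is at most `κ * w`; the power `1 / (p - 1)` turns this bound into `Gam`.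
    have h1 : b r ≤ κ * mean N w r := by
      have e : κ * mean N w r = mean N (fun s => κ * w s) r := by
        rw [mean, mean, ← intervalIntegral.integral_const_mul]
        congr 1 with s
        simp only [kernel]; ring
      rw [e, hbe r hr]
      exact mean_mono hr.1 hSm hSC (hw.measurable.const_mul κ) hwκC fun s _ => hbw _ _ _
    have hmn : 0 ≤ mean N w r := mean_nonneg hr.1 fun s _ => hw0 s
    calc b r ^ c ≤ (κ * mean N w r) ^ c := Real.rpow_le_rpow (hbn r) h1 hc.le
      _ = (M ^ (p - 1) * (k₁ N p ρ w * mean N w r)) ^ c := by rw [hκ]; congr 1; ring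
      _ = Gam N p ρ w M r := by
        rw [Real.mul_rpow (Real.rpow_nonneg hM.le _) (mul_nonneg hk₁ hmn),
          rpow_rpow_one_div hp hM.le, Gam_eq hp hw0 hr.1]
  have hGi : ∀ r ∈ Icc 0 ρ, IntervalIntegrable (fun θ => Gam N p ρ w M θ) volume r ρ :=
    fun r hr => by
      refine ContinuousOn.intervalIntegrable_of_Icc hr.2 ?_
      refine ContinuousOn.congr (f := fun r => M * (k₁ N p ρ w * mean N w r) ^ c)
        (continuousOn_const.mul ((Real.continuous_rpow_const hc.le).comp_continuousOn
          (continuousOn_const.mul ((continuousOn_mean hw.measurable hwC hρ.le).mono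
            (Icc_subset_Icc_left hr.1))))) fun θ hθ => Gam_eq hp hw0 (hr.1.trans hθ.1)
  have hvΦ : ∀ r ∈ Icc 0 ρ, v r ≤ Phi N p ρ w M r := fun r hr => by
    rw [Phi_eq]
    exact intervalIntegral.integral_mono_on hr.2 (hQc.intervalIntegrable _ _) (hGi r hr)
      fun θ hθ => hQΓ θ ⟨hr.1.trans hθ.1, hθ.2⟩
  have hvM : ∀ r ∈ Icc 0 ρ, v r ≤ M := fun r hr =>
    (hvΦ r hr).trans (Phi_le hp hρ hw hw0 hwC hne hM.le hr)
  have hQΓ' : ∀ r ∈ Icc 0 ρ, b r ^ c ≤ Γ := fun r hr =>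
    (hQΓ r hr).trans (Gam_le hp hρ.le hw.measurable hw0 hwC hM.le hr)
  -- lower barrier
  have hlow : ∀ θ ∈ Icc t ρ,
      δ * (k₂ N p ρ w * ∫ s in (0 : ℝ)..t, kernel N w s θ) ^ c ≤ b θ ^ c := fun θ hθ => by
    have hθ0 : 0 < θ := ht'.1.trans_le hθ.1
    have hIn : 0 ≤ ∫ s in (0 : ℝ)..t, kernel N w s θ := integral_kernel_nonneg hw0 ht.1 hθ0.le
    -- Only the mass on `[0, t]` is kept, where `H2` bounds the source below; the rest of the mean
    -- is nonnegative.
    have h1 : δ ^ (p - 1) * (k₂ N p ρ w * ∫ s in (0 : ℝ)..t, kernel N w s θ) ≤ b θ := by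
      rw [hbe θ ⟨hθ0.le, hθ.2⟩, mean, ← intervalIntegral.integral_add_adjacent_intervals
        (intervalIntegrable_kernel hSm hSC le_rfl ht.1 hθ.1)
        (intervalIntegrable_kernel hSm hSC ht.1 hθ.1 le_rfl)]
      have h2 : 0 ≤ ∫ s in t..θ, kernel N S s θ :=
        intervalIntegral.integral_nonneg hθ.1 fun s hs =>
          kernel_nonneg (ht.1.trans hs.1) hθ0.le (hb0 _ _ _)
      refine le_add_of_le_of_nonneg ?_ h2
      rw [← mul_assoc, ← intervalIntegral.integral_const_mul]
      refine intervalIntegral.integral_mono_on ht.1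
        ((intervalIntegrable_kernel hw.measurable hwC le_rfl ht.1 hθ.1).const_mul _)
        (intervalIntegrable_kernel hSm hSC le_rfl ht.1 hθ.1) fun s hs => ?_
      have h3 : δ ^ (p - 1) * k₂ N p ρ w ≤ F (max (L s) (min (v s) M), min (b s ^ c) Γ) := by
        rw [hFh, mul_comm]
        have hLs : L s = δ := if_pos hs.2
        exact H2 _ _ (by rw [hLs]; exact le_max_left _ _) (max_le (hLM s) (min_le_right _ _))
          (le_max_left _ _) (max_le hΓ0 (min_le_right _ _))
      rw [kernel, kernel, hSv]
      have h4 : 0 ≤ (s / θ) ^ (N - 1) := pow_nonneg (div_nonneg hs.1 hθ0.le) _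
      calc _ = (s / θ) ^ (N - 1) * (w s * (δ ^ (p - 1) * k₂ N p ρ w)) := by ring
        _ ≤ _ := mul_le_mul_of_nonneg_left (mul_le_mul_of_nonneg_left h3 (hw0 s)) h4
    calc _ = (δ ^ (p - 1) * (k₂ N p ρ w * ∫ s in (0 : ℝ)..t, kernel N w s θ)) ^ c := by
          rw [Real.mul_rpow (Real.rpow_nonneg hδ.le _) (mul_nonneg hk₂.le hIn),
            rpow_rpow_one_div hp hδ.le]
      _ ≤ b θ ^ c := Real.rpow_le_rpow
        (mul_nonneg (Real.rpow_nonneg hδ.le _) (mul_nonneg hk₂.le hIn)) h1 hc.le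
  have hlowc : ContinuousOn (fun θ => δ *
      (k₂ N p ρ w * ∫ s in (0 : ℝ)..t, kernel N w s θ) ^ c) (Icc t ρ) :=
    continuousOn_const.mul ((Real.continuous_rpow_const hc.le).comp_continuousOn
      (continuousOn_const.mul (continuousOn_integral_kernel ht'.1)))
  have hlowv : ∀ r ∈ Icc t ρ, ∫ θ in r..ρ,
      δ * (k₂ N p ρ w * ∫ s in (0 : ℝ)..t, kernel N w s θ) ^ c ≤ v r := fun r hr =>
    intervalIntegral.integral_mono_on hr.2
      ((hlowc.mono (Icc_subset_Icc_left hr.1)).intervalIntegrable_of_Icc hr.2)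
      (hQc.intervalIntegrable _ _) fun θ hθ => hlow θ ⟨hr.1.trans hθ.1, hθ.2⟩
  have hvt : δ ≤ v t := by
    refine le_trans (le_of_eq ?_) (hlowv t ⟨le_rfl, ht.2⟩)
    -- At `t` the lower barrier is `δ * k₂^c` times the maximum of `k₂Aux`, which is exactly `δ`.
    have e : ∫ θ in t..ρ, δ * (k₂ N p ρ w * ∫ s in (0 : ℝ)..t, kernel N w s θ) ^ c =
        δ * (k₂ N p ρ w ^ c * k₂Aux N p ρ w t) := by
      rw [k₂Aux, ← intervalIntegral.integral_const_mul, ← intervalIntegral.integral_const_mul]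
      refine intervalIntegral.integral_congr fun θ hθ => ?_
      rw [uIcc_of_le ht.2] at hθ
      rw [Real.mul_rpow hk₂.le (integral_kernel_nonneg hw0 ht.1 (ht.1.trans hθ.1))]
    rw [e, hk₂e, rpow_neg_rpow_one_div_mul hp hapos, mul_one]
  have hvt' : ∀ r ≤ t, δ ≤ v r := fun r hr => by
    have : v r = (∫ θ in r..t, b θ ^ c) + v t :=
      (intervalIntegral.integral_add_adjacent_intervals (hQc.intervalIntegrable _ _)
        (hQc.intervalIntegrable _ _)).symm
    rw [this]
    exact le_add_of_nonneg_of_le (intervalIntegral.integral_nonneg hr fun θ _ => hQ0 θ) hvt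
  have hΨ : ∀ r ∈ Icc 0 ρ, Psi N p ρ w t δ r ≤ v r := fun r hr => by
    rcases le_or_gt r t with h1 | h1
    · rw [Psi, if_pos h1]; exact hvt' r h1
    · rw [Psi_of_lt hp hw0 hk₂.le ht.1 h1 hr.2]
      exact hlowv r ⟨h1.le, hr.2⟩
  -- the truncation is inactive
  have hLv : ∀ r ∈ Icc 0 ρ, L r ≤ v r := fun r hr => by
    simp only [hL]
    split_ifs with h1
    · exact hvt' r h1
    · exact hv0 r hr.2
  have hSf : ∀ r ∈ Icc 0 ρ, S r = w r * f (v r) (b r ^ c) := fun r hr => by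
    rw [hSv, hFh, min_eq_left (hvM r hr), max_eq_right (hLv r hr), min_eq_left (hQΓ' r hr),
      max_eq_right (hQ0 r)]
  -- On `[0, ρ]` this is the source `S` with the inactive cut-offs removed; composing with `clamp`
  -- makes it continuous and bounded on the whole line, as the regularity results require.
  set G : ℝ → ℝ := fun s => w s * f (v (clamp ρ s)) (b (clamp ρ s) ^ c) with hG
  have hfG : ∀ s, 0 ≤ f (v (clamp ρ s)) (b (clamp ρ s) ^ c) ∧
      f (v (clamp ρ s)) (b (clamp ρ s) ^ c) ≤ κ := fun s => by
    have hs := clamp_mem hρ.le s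
    exact H1 _ _ (hv0 _ hs.2) (hvM _ hs) (hQ0 _) (hQΓ' _ hs)
  have hGS : ∀ r ∈ Icc 0 ρ, G r = S r := fun r hr => by
    simp only [hG]; rw [clamp_of_mem hr, hSf r hr]
  have hmG : ∀ r ∈ Icc 0 ρ, mean N G r = b r := fun r hr => by
    rw [hbe r hr]
    exact mean_congr hr.1 fun s hs => hGS s ⟨hs.1, hs.2.trans hr.2⟩
  have htG : ∀ r ∈ Icc 0 ρ, torsion N p ρ G r = v r := fun r hr => by
    rw [torsion_eq]
    refine intervalIntegral.integral_congr fun θ hθ => ?_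
    rw [uIcc_of_le hr.2] at hθ
    simp only [hmG θ ⟨hr.1.trans hθ.1, hθ.2⟩, hcdef]
  refine ⟨G, C * κ, ?_, fun s => mul_nonneg (hw0 s) (hfG s).1, fun s => ?_, fun r hr => ?_⟩
  · refine hw.mul (hf.comp_continuous
      (f := fun s => (v (clamp ρ s), b (clamp ρ s) ^ c)) ?_ fun s => ?_)
    · exact (hvc.comp (continuous_clamp ρ)).prodMk (hQc.comp (continuous_clamp ρ))
    · exact ⟨hv0 _ (clamp_mem hρ.le s).2, hQ0 _⟩
  · rw [hG, abs_mul, abs_of_nonneg (hfG s).1]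
    exact mul_le_mul (hwC s) (hfG s).2 (hfG s).1 hC
  · rw [hmG r hr, htG r hr, hGS r hr]
    exact ⟨hSf r hr, hΨ r hr, hvΦ r hr, hQΓ r hr⟩

end Profile

/-! ### All quantities depend only on the values of the weight on `[0, ρ]`. -/

section Congr

variable {N : ℕ} {w W : ℝ → ℝ} {p ρ : ℝ}

theorem integral_kernel_congr (h : ∀ s ∈ Icc 0 ρ, w s = W s) {a : ℝ} (ha : a ∈ Icc 0 ρ) (θ : ℝ) :
    ∫ s in (0 : ℝ)..a, kernel N w s θ = ∫ s in (0 : ℝ)..a, kernel N W s θ := by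
  refine intervalIntegral.integral_congr fun s hs => ?_
  rw [uIcc_of_le ha.1] at hs
  simp only [kernel, h s ⟨hs.1, hs.2.trans ha.2⟩]

theorem torsion_congr (h : ∀ s ∈ Icc 0 ρ, w s = W s) {r : ℝ} (hr : r ∈ Icc 0 ρ) :
    torsion N p ρ w r = torsion N p ρ W r := by
  refine intervalIntegral.integral_congr fun θ hθ => ?_
  rw [uIcc_of_le hr.2] at hθ
  simp only [integral_kernel_congr h ⟨hr.1.trans hθ.1, hθ.2⟩ θ]

theorem k₁_congr (h : ∀ s ∈ Icc 0 ρ, w s = W s) : k₁ N p ρ w = k₁ N p ρ W := by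
  rw [k₁, k₁, image_congr fun r hr => by rw [torsion_congr h hr]]

theorem k₂Aux_congr (h : ∀ s ∈ Icc 0 ρ, w s = W s) {r : ℝ} (hr : r ∈ Icc 0 ρ) :
    k₂Aux N p ρ w r = k₂Aux N p ρ W r := by
  simp only [k₂Aux, integral_kernel_congr h hr]

theorem k₂_congr (h : ∀ s ∈ Icc 0 ρ, w s = W s) : k₂ N p ρ w = k₂ N p ρ W := by
  rw [k₂, k₂, image_congr fun r hr => k₂Aux_congr h hr]

theorem gam_congr (h : ∀ s ∈ Icc 0 ρ, w s = W s) : gam N p ρ w = gam N p ρ W := by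
  rw [gam, gam, image_congr fun r hr => by rw [integral_kernel_congr h hr, k₁_congr h]]

theorem Psi_congr (h : ∀ s ∈ Icc 0 ρ, w s = W s) {t : ℝ} (ht : t ∈ Icc 0 ρ) (δ r : ℝ) :
    Psi N p ρ w t δ r = Psi N p ρ W t δ r := by
  simp only [Psi, integral_kernel_congr h ht, k₂_congr h]

theorem Gam_congr (h : ∀ s ∈ Icc 0 ρ, w s = W s) {r : ℝ} (hr : r ∈ Icc 0 ρ) (M : ℝ) :
    Gam N p ρ w M r = Gam N p ρ W M r := by
  rw [Gam, Gam, integral_kernel_congr h hr, k₁_congr h]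

theorem Phi_congr (h : ∀ s ∈ Icc 0 ρ, w s = W s) {r : ℝ} (hr : r ∈ Icc 0 ρ) (M : ℝ) :
    Phi N p ρ w M r = Phi N p ρ W M r := by
  rw [Phi_eq, Phi_eq]
  refine intervalIntegral.integral_congr fun θ hθ => ?_
  rw [uIcc_of_le hr.2] at hθ
  exact Gam_congr h ⟨hr.1.trans hθ.1, hθ.2⟩ M

end Congr

theorem eLpNorm_top_le {N : ℕ} {F : Type*} [NormedAddCommGroup F]
    {D : Set (EuclideanSpace ℝ (Fin N))} (hD : MeasurableSet D)
    {u : EuclideanSpace ℝ (Fin N) → F} {K : ℝ} (h : ∀ x ∈ D, ‖u x‖ ≤ K) :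
    eLpNorm u ⊤ (volume.restrict D) ≤ ENNReal.ofReal K := by
  rw [eLpNorm_exponent_top]
  refine eLpNormEssSup_le_of_ae_bound ?_
  filter_upwards [ae_restrict_mem hD] with x hx using h x hx

/-- An essential supremum below `K` would force `|u| < K` almost everywhere on `B`, making `B` null.
-/
theorem le_eLpNorm_top {N : ℕ} {D B : Set (EuclideanSpace ℝ (Fin N))} (hBD : B ⊆ D)
    (hB : volume B ≠ 0) {u : EuclideanSpace ℝ (Fin N) → ℝ} {K : ℝ}
    (h : ∀ x ∈ B, K ≤ u x) :
    ENNReal.ofReal K ≤ eLpNorm u ⊤ (volume.restrict D) := by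
  refine le_trans ?_ (eLpNorm_mono_measure u (Measure.restrict_mono hBD le_rfl))
  rw [eLpNorm_exponent_top]
  by_contra! hlt
  apply hB
  have h1 := ae_lt_of_essSup_lt hlt
  have h2 : ∀ᵐ x ∂(volume.restrict B), x ∉ B := by
    filter_upwards [h1] with x hx hxB
    refine hx.not_ge ?_
    rw [← ofReal_norm]
    exact ENNReal.ofReal_le_ofReal ((h x hxB).trans (le_abs_self _))
  rw [ae_iff] at h2
  simp only [not_not] at h2
  exact (Measure.restrict_apply_self volume B).symm.trans h2

end

end RadialPLaplace

/-! ### Assembly of the theorem. -/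

section Main

open RadialPLaplace

theorem theorem4p1 (N : ℕ) (hN : 2 ≤ N) (p : ℝ) (hp : 1 < p) (ρ : ℝ) (hρ : 0 < ρ)
    (x₀ : EuclideanSpace ℝ (Fin N))
    (w : ℝ → ℝ) (hw : ContinuousOn w (Icc 0 ρ)) (hw_nonneg : ∀ s ∈ Icc 0 ρ, 0 ≤ w s)
    (hw_ne : ∃ s ∈ Icc 0 ρ, w s ≠ 0)
    (t : ℝ) (ht : t ∈ Icc 0 ρ) (ht_max : IsMaxOn (RadialPLaplace.k₂Aux N p ρ w) (Icc 0 ρ) t)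
    (f : ℝ → ℝ → ℝ) (hf : ContinuousOn (Function.uncurry f) (Ici 0 ×ˢ Ici 0))
    (δ M : ℝ) (hδ : 0 < δ) (hδM : δ < M)
    (H1 : ∀ u v : ℝ, 0 ≤ u → u ≤ M → |v| ≤ RadialPLaplace.gam N p ρ w * M →
      0 ≤ f u |v| ∧ f u |v| ≤ RadialPLaplace.k₁ N p ρ w * M ^ (p - 1))
    (H2 : ∀ u v : ℝ, δ ≤ u → u ≤ M → |v| ≤ RadialPLaplace.gam N p ρ w * M →
      RadialPLaplace.k₂ N p ρ w * δ ^ (p - 1) ≤ f u |v|) :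
    -- the function in terms of which `k₁` is defined solves the problem with right side `w`
    RadialPLaplace.IsWeakSolution p (ball x₀ ρ) (fun x _ _ => w ‖x - x₀‖)
      (fun x => RadialPLaplace.torsion N p ρ w ‖x - x₀‖)
      (gradient fun x => RadialPLaplace.torsion N p ρ w ‖x - x₀‖) ∧
    ∃ (v : ℝ → ℝ) (u : EuclideanSpace ℝ (Fin N) → ℝ),
      (∀ x, u x = v ‖x - x₀‖) ∧
      ContDiffOn ℝ 1 u (closedBall x₀ ρ) ∧
      RadialPLaplace.IsWeakSolution p (ball x₀ ρ)
        (fun x z ξ => w ‖x - x₀‖ * f z ‖ξ‖) u (gradient u) ∧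
      (∀ x ∈ ball x₀ ρ, 0 < u x) ∧
      (∀ x ∈ closedBall x₀ ρ, RadialPLaplace.Psi N p ρ w t δ ‖x - x₀‖ ≤ u x ∧
        u x ≤ RadialPLaplace.Phi N p ρ w M ‖x - x₀‖) ∧
      (∀ x ∈ ball x₀ ρ, ‖gradient u x‖ ≤ RadialPLaplace.Gam N p ρ w M ‖x - x₀‖) ∧
      ENNReal.ofReal δ ≤ eLpNorm u ⊤ (volume.restrict (ball x₀ ρ)) ∧
      eLpNorm u ⊤ (volume.restrict (ball x₀ ρ)) ≤ ENNReal.ofReal M ∧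
      eLpNorm (gradient u) ⊤ (volume.restrict (ball x₀ ρ)) ≤
        ENNReal.ofReal (RadialPLaplace.gam N p ρ w * M) := by
  -- The weight is known to be continuous and nonnegative only on `[0, ρ]`; it is replaced by its
  -- constant extension `W`, which leaves every constant and barrier unchanged.
  have hcl : ∀ s ∈ Icc 0 ρ, w s = (w ∘ clamp ρ) s := fun s hs => by
    rw [Function.comp_apply, clamp_of_mem hs]
  set W := w ∘ clamp ρ with hWdef
  have hW : Continuous W := hw.comp_continuous (continuous_clamp ρ) (clamp_mem hρ.le)
  have hW0 : ∀ s, 0 ≤ W s := fun s => hw_nonneg _ (clamp_mem hρ.le s)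
  obtain ⟨C, hC⟩ := isCompact_Icc.exists_bound_of_continuousOn hw
  have hWC : ∀ s, |W s| ≤ C := fun s => hC _ (clamp_mem hρ.le s)
  have hWne : ∃ s ∈ Icc 0 ρ, W s ≠ 0 := by
    obtain ⟨s, hs, h⟩ := hw_ne
    exact ⟨s, hs, by rwa [← hcl s hs]⟩
  have hWmax : IsMaxOn (k₂Aux N p ρ W) (Icc 0 ρ) t := fun r hr => by
    have := ht_max hr
    simp only [mem_ofPred_eq] at this ⊢
    rwa [← k₂Aux_congr hcl hr, ← k₂Aux_congr hcl ht]
  have hdist : ∀ x ∈ closedBall x₀ ρ, ‖x - x₀‖ ∈ Icc 0 ρ := fun x hx =>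
    ⟨norm_nonneg _, by rwa [← dist_eq_norm]⟩
  have hbc : ∀ x ∈ ball x₀ ρ, x ∈ closedBall x₀ ρ := fun x hx => ball_subset_closedBall hx
  refine ⟨isWeakSolution_radial hN hp hρ hW hW0 hWC
    (fun x hx => torsion_congr hcl (hdist x hx)) fun x hx => hcl _ (hdist x (hbc x hx)), ?_⟩
  have hM : 0 < M := hδ.trans hδM
  obtain ⟨G, C', hG, hG0, hGC, hsol⟩ := exists_source (N := N) hp hρ hW hW0 hWC hWne ht hWmax hf hδ
    hδM
    (fun u z hu huM hz hzM => by
      have := H1 u z hu huM (by rwa [abs_of_nonneg hz, gam_congr hcl])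
      rwa [abs_of_nonneg hz, k₁_congr hcl] at this)
    (fun u z hu huM hz hzM => by
      have := H2 u z hu huM (by rwa [abs_of_nonneg hz, gam_congr hcl])
      rwa [abs_of_nonneg hz, k₂_congr hcl] at this)
  have hpos := k₂Aux_pos (N := N) hp hρ hW hW0 hWne hWmax
  have ht' := mem_Ioo_of_isMaxOn_k₂Aux hp ht hpos
  have hk₂ : 0 < k₂ N p ρ W := by
    rw [k₂_eq ht hWmax]; exact Real.rpow_pos_of_pos hpos _
  have hI := integral_pow_mul_pos_of_k₂Aux_pos hp hW0 ht' hpos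
  set u : EuclideanSpace ℝ (Fin N) → ℝ := fun x => torsion N p ρ G ‖x - x₀‖ with hu
  have hgrad : ∀ x, gradient u x = radialGrad N p G x₀ x := fun x =>
    (hasGradientAt_torsion hp hρ.le hG hGC x).gradient
  have hgn : ∀ x, ‖gradient u x‖ = mean N G ‖x - x₀‖ ^ (1 / (p - 1)) := fun x => by
    rw [hgrad, norm_radialGrad hp hG0]
  have hu0 : ∀ x ∈ ball x₀ ρ, 0 < u x := fun x hx => by
    have hr : ‖x - x₀‖ < ρ := by rwa [← dist_eq_norm]
    exact (Psi_pos hp hW0 hk₂ ht' hI hδ hr).trans_le (hsol _ (hdist x (hbc x hx))).2.1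
  have hGr : ∀ x ∈ ball x₀ ρ, ‖gradient u x‖ ≤ Gam N p ρ W M ‖x - x₀‖ := fun x hx => by
    rw [hgn]
    exact (hsol _ (hdist x (hbc x hx))).2.2.2
  refine ⟨torsion N p ρ G, u, fun x => rfl, (contDiff_torsion hp hρ.le hG hG0 hGC).contDiffOn,
    isWeakSolution_radial hN hp hρ hG hG0 hGC (fun x _ => rfl) fun x hx => ?_, hu0,
    fun x hx => ?_, fun x hx => ?_, ?_, ?_, ?_⟩
  · have hr := hdist x (hbc x hx)
    rw [hgn, hcl _ hr]
    exact (hsol _ hr).1.symm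
  · have hr := hdist x hx
    rw [Psi_congr hcl ht, Phi_congr hcl hr]
    exact ⟨(hsol _ hr).2.1, (hsol _ hr).2.2.1⟩
  · rw [Gam_congr hcl (hdist x (hbc x hx))]
    exact hGr x hx
  -- The lower barrier equals `δ` on the ball of radius `t`, which has positive measure because `t >
  -- 0`.
  · refine le_eLpNorm_top (ball_subset_ball ht'.2.le) (measure_ball_pos volume x₀ ht'.1).ne'
      fun x hx => ?_
    have hr : ‖x - x₀‖ ≤ t := by rw [← dist_eq_norm]; exact (mem_ball.1 hx).le
    have := (hsol ‖x - x₀‖ ⟨norm_nonneg _, hr.trans ht.2⟩).2.1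
    rwa [Psi, if_pos hr] at this
  · refine eLpNorm_top_le measurableSet_ball fun x hx => ?_
    have hr := hdist x (hbc x hx)
    rw [Real.norm_of_nonneg (hu0 x hx).le]
    exact (hsol _ hr).2.2.1.trans (Phi_le hp hρ hW hW0 hWC hWne hM.le hr)
  · refine eLpNorm_top_le measurableSet_ball fun x hx => (hGr x hx).trans ?_
    rw [gam_congr hcl]
    exact Gam_le hp hρ.le hW.measurable hW0 hWC hM.le (hdist x (hbc x hx))

end Main
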